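/- All matroids have a finite ground set; $U_{k,n}$ is the uniform matroid of rank $k$ on $n$ elements. For a matroid $M$ and a flat $F$, let $M^F$ be the restriction of $M$ to $F$ and $M_F$ the contraction of $M$ by $F$, and let $\chi_M(t)=\sum_{A\subseteq E}(-1)^{|A|}t^{\operatorname{rk}M-\operatorname{rk}A}$ be the characteristic polynomial of a matroid $M$ with ground set $E$. The Kazhdan–Lusztig polynomial $P_M(t)\in\mathbb Z[t]$ and the inverse Kazhdan–Lusztig polynomial $Q_M(t)\in\mathbb Z[t]$ are the unique assignments such that: (i) if $\operatorname{rk}M=0$, then $P_M=Q_M=1$ when $E=\varnothing$, and $P_M=Q_M=0$ otherwise; (ii) if $\operatorname{rk}M>0$, then $\deg P_M,\deg Q_M<\tfrac12\operatorname{rk}M$; (iii) for every $M$, with sums over all flats $F$ of $M$, $$t^{\operatorname{rk}M}P_M(t^{-1})=\sum_F\chi_{M^F}(t)\,P_{M_F}(t),\qquad (-t)^{\operatorname{rk}M}Q_M(t^{-1})=\sum_F(-1)^{\operatorname{rk}F}Q_{M^F}(t)\,t^{\operatorname{rk}M-\operatorname{rk}F}\chi_{M_F}(t^{-1}).$$ The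 $Z$-polynomial is $Z_M(t)=\sum_F t^{\operatorname{rk}F}P_{M_F}(t)$. A hyperplane $H$ (a flat of rank $\operatorname{rk}M-1$) of a matroid $M$ of rank $k$ is stressed if all subsets of $H$ of cardinality $k$ are circuits. Its relaxation $\widetilde M$ is then the matroid on the same ground set whose bases are those of $M$ together with all $k$-element subsets of $H$. A matroid of rank $k$ is paving if all its circuits have at least $k$ elements. **Theorem.** There are polynomials $p_{k,h}(t),q_{k,h}(t),z_{k,h}(t)\in\mathbb Z[t]$, depending only on $k$ and $h$, with the following two properties. (a) For all integers $k,h\ge1$ and every matroid $M$ of rank $k$ with a stressed hyperplane $H$ of cardinality $h$, the relaxation $\widetilde M$ of $H$ satisfies $$P_{\widetilde M}=P_M+p_{k,h},\qquad Q_{\widetilde M}=Q_M+q_{k,h},\qquad Z_{\widetilde M}=Z_M+z_{k,h}.$$ (b) For every paving matroid $M$ of rank $k$ on $n$ elements with exactly $\lambda_h$ hyperplanes of cardinality $h$ (for each $h$), $$P_M=P_{U_{k,n}}-\sum_{h\ge k}\lambda_h\,p_{k,h},\qquad Q_M=Q_{U_{k,n}}-\sum_{h\ge k}\lambda_h\,q_{k,h},\qquad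 Z_M=Z_{U_{k,n}}-\sum_{h\ge k}\lambda_h\,z_{k,h}.$$ -/

import Mathlib

open scoped Polynomial

universe u

namespace Matroid

/-- The rank of `M` as a natural number (meaningful for finite matroids). -/
noncomputable def natRank {α : Type u} (M : Matroid α) : ℕ := M.eRank.toNat

/-- The rank of the set `A` in `M` as a natural number (meaningful for finite matroids). -/
noncomputable def natRk {α : Type u} (M : Matroid α) (A : Set α) : ℕ := (M.eRk A).toNat

/-- A hyperplane is a flat of rank `rk M - 1`. In a matroid of rank `0` there is none. -/
def IsHyperplane {α : Type u} (M : Matroid α) (H : Set α) : Prop :=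
  M.IsFlat H ∧ M.eRk H + 1 = M.eRank

/-- A hyperplane is stressed if all its subsets of cardinality `rk M` are circuits. -/
def IsStressedHyperplane {α : Type u} (M : Matroid α) (H : Set α) : Prop :=
  M.IsHyperplane H ∧ ∀ S ⊆ H, S.encard = M.eRank → M.IsCircuit S

/-- A matroid is paving if all its circuits have at least `rk M` elements. -/
def IsPaving {α : Type u} (M : Matroid α) : Prop :=
  ∀ C, M.IsCircuit C → M.eRank ≤ C.encard

/-- The number of hyperplanes of cardinality `h`. -/
noncomputable def numHyperplanes {α : Type u} (M : Matroid α) (h : ℕ) : ℕ :=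
  {H : Set α | M.IsHyperplane H ∧ H.ncard = h}.ncard

/-- The uniform matroid `U_{k,n}`: the independent sets are the subsets of the `n`-element ground
set with at most `k` elements. For `k ≤ n` its bases are exactly the `k`-subsets. -/
def uniform (k n : ℕ) : Matroid (Fin n) :=
  (IndepMatroid.ofFinite (E := Set.univ) Set.finite_univ (fun I => I.ncard ≤ k)
    (by simp)
    (fun I J hJ hIJ => (Set.ncard_le_ncard hIJ (Set.toFinite J)).trans hJ)
    (by
      intro I J hI hJ hlt
      obtain ⟨e, heJ, heI⟩ := Set.exists_mem_notMem_of_ncard_lt_ncard hlt (Set.toFinite I)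
      refine ⟨e, heJ, heI, ?_⟩
      rw [Set.ncard_insert_of_notMem heI (Set.toFinite I)]
      omega)
    (fun I _ => Set.subset_univ I)).matroid

theorem uniform_indep_iff (k n : ℕ) (I : Set (Fin n)) :
    (uniform k n).Indep I ↔ I.ncard ≤ k := Iff.rfl

theorem uniform_isBase_iff {k n : ℕ} (hkn : k ≤ n) (B : Set (Fin n)) :
    (uniform k n).IsBase B ↔ B.ncard = k := by
  rw [isBase_iff_maximal_indep]
  constructor
  · intro h
    have h1 : B.ncard ≤ k := h.prop
    by_contra hne
    have hlt : B.ncard < (Set.univ : Set (Fin n)).ncard := by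
      rw [Set.ncard_univ, Nat.card_fin]; omega
    obtain ⟨e, -, he⟩ := Set.exists_mem_notMem_of_ncard_lt_ncard hlt (Set.toFinite B)
    have hi : (uniform k n).Indep (insert e B) := by
      rw [uniform_indep_iff, Set.ncard_insert_of_notMem he (Set.toFinite B)]
      omega
    exact he (h.le_of_ge hi (Set.subset_insert e B) (Set.mem_insert e B))
  · intro h
    refine ⟨h.le, fun J hJ hBJ => ?_⟩
    have hJ' : J.ncard ≤ k := hJ
    exact (Set.eq_of_subset_of_ncard_le hBJ (by omega) (Set.toFinite J)).symm.subset

theorem relax_exchange {α : Type u} {M : Matroid α} [M.Finite] {H : Set α}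
    (hH : M.IsStressedHyperplane H) :
    ExchangeProperty (fun B => M.IsBase B ∨ (B ⊆ H ∧ B.encard = M.eRank)) := by
  obtain ⟨⟨hflat, hrk⟩, hstr⟩ := hH
  have hHE : H ⊆ M.E := hflat.subset_ground
  have hHfin : H.Finite := M.ground_finite.subset hHE
  intro B₁ B₂ h₁ h₂ a ha
  have hB₁fin : B₁.Finite := by
    rcases h₁ with h | h
    · exact h.finite
    · exact hHfin.subset h.1
  have hB₂fin : B₂.Finite := by
    rcases h₂ with h | h
    · exact h.finite
    · exact hHfin.subset h.1
  have hc₁ : B₁.encard = M.eRank := by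
    rcases h₁ with h | h
    · exact h.encard_eq_eRank
    · exact h.2
  have hc₂ : B₂.encard = M.eRank := by
    rcases h₂ with h | h
    · exact h.encard_eq_eRank
    · exact h.2
  have hcard : ∀ b, b ∉ B₁ → (insert b (B₁ \ {a})).encard = M.eRank := by
    intro b hb
    rw [Set.encard_insert_of_notMem (fun hb' => hb hb'.1),
      Set.encard_sdiff_singleton_add_one ha.1, hc₁]
  have hind : M.Indep (B₁ \ {a}) := by
    rcases h₁ with h | h
    · exact h.indep.subset Set.sdiff_subset
    · exact (hstr _ h.1 h.2).sdiff_singleton_indep ha.1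
  have hbase : ∀ b, b ∉ B₁ → M.Indep (insert b (B₁ \ {a})) →
      M.IsBase (insert b (B₁ \ {a})) := by
    intro b hb hi
    refine hi.isBase_of_eRk_ge ((hB₁fin.sdiff).insert b) ?_
    rw [hi.eRk_eq_encard, hcard b hb]
  by_cases hB₂ : M.IsBase B₂
  · -- the second set is an old basis: augment
    have hnb : ¬ M.IsBase (B₁ \ {a}) := by
      intro hb
      have h3 := hb.encard_eq_eRank
      have h4 := Set.encard_sdiff_singleton_add_one ha.1
      rw [h3, hc₁] at h4
      have h5 : M.eRank ≠ ⊤ := by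
        rw [← hc₁]; exact hB₁fin.encard_lt_top.ne
      have := (ENat.add_one_le_iff h5).1 h4.le
      exact lt_irrefl _ this
    obtain ⟨e, he, hei⟩ := hind.exists_insert_of_not_isBase hnb hB₂
    have heB₁ : e ∉ B₁ := by
      intro h
      exact he.2 ⟨h, fun h' => ha.2 (h' ▸ he.1)⟩
    exact ⟨e, ⟨he.1, heB₁⟩, Or.inl (hbase e heB₁ hei)⟩
  · have hB₂H : B₂ ⊆ H := (h₂.resolve_left hB₂).1
    by_cases hsub : B₁ \ {a} ⊆ H
    · -- everything takes place inside `H`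
      have hns : ¬ B₂ ⊆ B₁ := by
        intro h
        have := hB₁fin.eq_of_subset_of_encard_le' h (by rw [hc₁, hc₂])
        exact ha.2 (this ▸ ha.1)
      obtain ⟨b, hb₂, hb₁⟩ := Set.not_subset.1 hns
      exact ⟨b, ⟨hb₂, hb₁⟩, Or.inr ⟨Set.insert_subset (hB₂H hb₂) hsub, hcard b hb₁⟩⟩
    · by_contra hno
      push Not at hno
      have hcl : B₂ ⊆ M.closure (B₁ \ {a}) := by
        intro b hb
        by_cases hb₁ : b ∈ B₁
        · exact M.mem_closure_of_mem' ⟨hb₁, fun h => ha.2 (h ▸ hb)⟩ (hHE (hB₂H hb))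
        · by_contra hbn
          have hi : M.Indep (insert b (B₁ \ {a})) :=
            (hind.notMem_closure_iff_of_notMem (fun h => hb₁ h.1)
              (hHE (hB₂H hb))).1 hbn
          exact (hno b ⟨hb, hb₁⟩).1 (hbase b hb₁ hi)
      have hcirc : M.IsCircuit B₂ := hstr B₂ hB₂H hc₂
      have e1 : M.eRk B₂ + 1 = M.eRk H + 1 := by rw [hcirc.eRk_add_one_eq, hc₂, hrk]
      have e2 : M.eRk (B₁ \ {a}) + 1 = M.eRk H + 1 := by
        rw [hind.eRk_eq_encard, Set.encard_sdiff_singleton_add_one ha.1, hc₁, hrk]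
      have e1' : M.eRk B₂ = M.eRk H := WithTop.add_right_cancel ENat.one_ne_top e1
      have e2' : M.eRk (B₁ \ {a}) = M.eRk H := WithTop.add_right_cancel ENat.one_ne_top e2
      have c1 : M.closure B₂ = M.closure H :=
        (M.isRkFinite_of_finite hB₂fin).closure_eq_closure_of_subset_of_eRk_ge_eRk hB₂H e1'.ge
      have c2 : M.closure B₂ = M.closure (M.closure (B₁ \ {a})) :=
        (M.isRkFinite_of_finite hB₂fin).closure_eq_closure_of_subset_of_eRk_ge_eRk hcl
          (by rw [eRk_closure_eq, e1', e2'])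
      rw [closure_closure, c1, hflat.closure] at c2
      apply hsub
      rw [c2]
      exact M.subset_closure _ hind.subset_ground

/-- The relaxation of a stressed hyperplane `H`: the bases are those of `M` together with
all subsets of `H` of cardinality `rk M`. -/
def relax {α : Type u} (M : Matroid α) [M.Finite] {H : Set α} (hH : M.IsStressedHyperplane H) :
    Matroid α :=
  Matroid.ofIsBaseOfFinite M.ground_finite
    (fun B => M.IsBase B ∨ (B ⊆ H ∧ B.encard = M.eRank))
    (by obtain ⟨B, hB⟩ := M.exists_isBase; exact ⟨B, Or.inl hB⟩)
    (relax_exchange hH)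
    (fun B hB => hB.elim (fun h => h.subset_ground)
      (fun h => h.1.trans hH.1.1.subset_ground))

/-- The characteristic polynomial
`χ_M(t) = (-1)^{rk M} T_M(1 - t, 0) = ∑_{A ⊆ E} (-1)^{|A|} t^{rk M - rk A}`
(equal to `0` if `M` has loops, and to the characteristic polynomial of the lattice of flats
otherwise). -/
noncomputable def charPoly {α : Type u} (M : Matroid α) : ℤ[X] :=
  ∑ᶠ A : {A : Set α // A ⊆ M.E},
    (-1) ^ (A : Set α).ncard * Polynomial.X ^ (M.natRank - M.natRk A)

/-- The part of `R` consisting of the terms of degree `i < k / 2`. -/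
noncomputable def lowHalf (k : ℕ) (R : ℤ[X]) : ℤ[X] :=
  ∑ i ∈ (Finset.range k).filter (fun i => 2 * i < k), Polynomial.monomial i (R.coeff i)

theorem coeff_lowHalf (k : ℕ) (R : ℤ[X]) (i : ℕ) :
    (lowHalf k R).coeff i = if 2 * i < k then R.coeff i else 0 := by
  simp only [lowHalf, Polynomial.finsetSum_coeff, Polynomial.coeff_monomial,
    Finset.sum_ite_eq', Finset.mem_filter, Finset.mem_range]
  by_cases h : 2 * i < k
  · rw [if_pos ⟨by omega, h⟩, if_pos h]
  · rw [if_neg (fun h' => h h'.2), if_neg h]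

open Classical in
/-- The Kazhdan--Lusztig polynomial `P_M`. It is the assignment determined by
* if `rk M = 0`, then `P_M = 1` for the empty ground set and `P_M = 0` otherwise;
* if `rk M > 0`, then `deg P_M < rk M / 2`;
* `t^{rk M} P_M(t⁻¹) = ∑_F χ_{M^F}(t) P_{M_F}(t)`, the sum running over all flats `F`.

The summand of `F = ∅` (if `∅` is a flat) is `P_M` itself, so the third condition says that the
sum over `F ≠ ∅` is `t^{rk M} P_M(t⁻¹) - P_M(t)`; its part of degree `< rk M / 2` is `-P_M`.
Here `M^F = M ↾ F` is the localization and `M_F = M ／ F` the contraction. -/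
noncomputable def klPoly {α : Type u} (M : Matroid α) : ℤ[X] :=
  if hM : M.Finite then
    if M.natRank = 0 then (if M.E = ∅ then 1 else 0)
    else - lowHalf M.natRank
      (∑ᶠ F : {F : Set α // M.IsFlat F ∧ F ≠ ∅},
        charPoly (M ↾ (F : Set α)) * klPoly (M ／ (F : Set α)))
  else 0
termination_by M.E.ncard
decreasing_by
  rw [contract_ground]
  refine Set.ncard_lt_ncard ?_ hM.ground_finite
  obtain ⟨x, hx⟩ := Set.nonempty_iff_ne_empty.2 F.2.2
  exact (Set.ssubset_iff_of_subset Set.sdiff_subset).2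
    ⟨x, F.2.1.subset_ground hx, fun h => h.2 hx⟩

open Classical in
/-- The inverse Kazhdan--Lusztig polynomial `Q_M`. It is the assignment determined by
* if `rk M = 0`, then `Q_M = 1` for the empty ground set and `Q_M = 0` otherwise;
* if `rk M > 0`, then `deg Q_M < rk M / 2`;
* `(-t)^{rk M} Q_M(t⁻¹) = ∑_F (-1)^{rk F} Q_{M^F}(t) t^{rk M - rk F} χ_{M_F}(t⁻¹)`,
  the sum running over all flats `F`.

The summand of `F = E` is `(-1)^{rk M} Q_M`, so the third condition says that the sum over
`F ≠ E` is `(-1)^{rk M} (t^{rk M} Q_M(t⁻¹) - Q_M(t))`.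
Here `Polynomial.reflect d p` is `t^d p(t⁻¹)` for `deg p ≤ d`. -/
noncomputable def invKLPoly {α : Type u} (M : Matroid α) : ℤ[X] :=
  if hM : M.Finite then
    if M.natRank = 0 then (if M.E = ∅ then 1 else 0)
    else - (-1) ^ M.natRank * lowHalf M.natRank
      (∑ᶠ F : {F : Set α // M.IsFlat F ∧ F ≠ M.E},
        (-1) ^ M.natRk F * invKLPoly (M ↾ (F : Set α)) *
          Polynomial.reflect (M.natRank - M.natRk F) (charPoly (M ／ (F : Set α))))
  else 0
termination_by M.E.ncard
decreasing_by
  rw [restrict_ground_eq]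
  exact Set.ncard_lt_ncard (F.2.1.subset_ground.ssubset_of_ne F.2.2) hM.ground_finite

/-- The `Z`-polynomial `Z_M(t) = ∑_F t^{rk F} P_{M_F}(t)`, the sum running over all flats. -/
noncomputable def zPoly {α : Type u} (M : Matroid α) : ℤ[X] :=
  ∑ᶠ F : {F : Set α // M.IsFlat F},
    Polynomial.X ^ M.natRk F * klPoly (M ／ (F : Set α))

/-! The remaining lemmas check that `klPoly` and `invKLPoly` are the only candidates for
assignments with the three defining properties. -/

theorem charPoly_eq_zero_of_isLoop {α : Type u} (M : Matroid α) [M.Finite] {e : α}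
    (he : M.IsLoop e) : charPoly M = 0 := by
  classical
  have heE : e ∈ M.E := he.mem_ground
  let g : {A : Set α // A ⊆ M.E} → {A : Set α // A ⊆ M.E} := fun A =>
    if e ∈ (A : Set α) then ⟨(A : Set α) \ {e}, Set.sdiff_subset.trans A.2⟩
    else ⟨insert e (A : Set α), Set.insert_subset heE A.2⟩
  have hg : Function.Involutive g := by
    rintro ⟨A, hA⟩
    by_cases h : e ∈ A
    · simp [g, h, Set.insert_eq_of_mem]
    · simp [g, h]
  have hrk : ∀ A : Set α, M.natRk (insert e A) = M.natRk A := by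
    intro A
    have h0 : M.eRk {e} ≤ 0 := he.eRk_eq.le
    rw [natRk, natRk, ← Set.union_singleton, eRk_eq_eRk_union_eRk_le_zero A h0]
  have hsign : ∀ A : {A : Set α // A ⊆ M.E},
      (-1 : ℤ[X]) ^ (g A : Set α).ncard * Polynomial.X ^ (M.natRank - M.natRk (g A))
        = -((-1) ^ (A : Set α).ncard * Polynomial.X ^ (M.natRank - M.natRk A)) := by
    rintro ⟨A, hA⟩
    have hAf : A.Finite := M.ground_finite.subset hA
    by_cases h : e ∈ A
    · have h1 : (A \ {e}).ncard + 1 = A.ncard := Set.ncard_sdiff_singleton_add_one h hAf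
      have h2 : M.natRk (A \ {e}) = M.natRk A := by
        rw [← hrk (A \ {e}), Set.insert_sdiff_singleton, Set.insert_eq_of_mem h]
      simp only [g, h, if_true, h2, ← h1, pow_succ]
      ring
    · simp only [g, h, if_false, hrk, Set.ncard_insert_of_notMem h hAf, pow_succ]
      ring
  have hsum : charPoly M = - charPoly M := by
    unfold charPoly
    rw [← finsum_neg_distrib, ← finsum_comp_equiv hg.toPerm]
    exact finsum_congr hsign
  exact self_eq_neg.1 hsum

theorem charPoly_eq_one {α : Type u} (M : Matroid α) (hE : M.E = ∅) : charPoly M = 1 := by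
  have : Unique {A : Set α // A ⊆ M.E} :=
    ⟨⟨⟨∅, Set.empty_subset _⟩⟩, fun A => Subtype.ext (Set.subset_empty_iff.1 (hE ▸ A.2))⟩
  have h0 : M.natRank = 0 := by
    rw [natRank, eRank_def, hE, eRk_empty]; rfl
  have hd : ((default : {A : Set α // A ⊆ M.E}) : Set α) = ∅ :=
    Set.subset_empty_iff.1 (hE ▸ (default : {A : Set α // A ⊆ M.E}).2)
  rw [charPoly, finsum_unique, hd, h0]
  simp

/-- Splitting off one flat from a sum over all flats. -/
theorem finsum_flats_split {α : Type u} (M : Matroid α) [M.Finite] (G : Set α) (hG : M.IsFlat G)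
    (f : Set α → ℤ[X]) :
    ∑ᶠ F : {F : Set α // M.IsFlat F}, f F
      = f G + ∑ᶠ F : {F : Set α // M.IsFlat F ∧ F ≠ G}, f F := by
  have hfin : {F : Set α | M.IsFlat F ∧ F ≠ G}.Finite :=
    M.ground_finite.finite_subsets.subset fun F hF => hF.1.subset_ground
  have h1 : ∑ᶠ F : {F : Set α // M.IsFlat F}, f F = ∑ᶠ F ∈ {F : Set α | M.IsFlat F}, f F :=
    finsum_set_coe_eq_finsum_mem {F : Set α | M.IsFlat F}
  have h2 : ∑ᶠ F : {F : Set α // M.IsFlat F ∧ F ≠ G}, f F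
      = ∑ᶠ F ∈ {F : Set α | M.IsFlat F ∧ F ≠ G}, f F :=
    finsum_set_coe_eq_finsum_mem {F : Set α | M.IsFlat F ∧ F ≠ G}
  have h3 : {F : Set α | M.IsFlat F} = insert G {F : Set α | M.IsFlat F ∧ F ≠ G} := by
    ext F
    by_cases h : F = G
    · simp [h, hG]
    · simp [h]
  rw [h1, h2, h3, finsum_mem_insert f (by simp) hfin]

theorem lowHalf_reflect {k : ℕ} {P : ℤ[X]} (hP : 2 * P.natDegree < k) :
    lowHalf k (Polynomial.reflect k P) = 0 ∧ lowHalf k P = P := by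
  constructor
  · ext i
    rw [coeff_lowHalf]
    split_ifs with h
    · rw [Polynomial.coeff_reflect, Polynomial.revAt_le (by omega),
        Polynomial.coeff_eq_zero_of_natDegree_lt (by omega), Polynomial.coeff_zero]
    · simp
  · ext i
    rw [coeff_lowHalf]
    split_ifs with h
    · rfl
    · rw [Polynomial.coeff_eq_zero_of_natDegree_lt (by omega)]

theorem lowHalf_add (k : ℕ) (R S : ℤ[X]) : lowHalf k (R + S) = lowHalf k R + lowHalf k S := by
  ext i
  simp only [coeff_lowHalf, Polynomial.coeff_add]
  split_ifs <;> simp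

theorem klPoly_unique {α : Type u} (P : Matroid α → ℤ[X])
    (h0 : ∀ M : Matroid α, M.Finite → M.natRank = 0 →
      (M.E = ∅ → P M = 1) ∧ (M.E ≠ ∅ → P M = 0))
    (hdeg : ∀ M : Matroid α, M.Finite → 0 < M.natRank → 2 * (P M).natDegree < M.natRank)
    (hrec : ∀ M : Matroid α, M.Finite → Polynomial.reflect M.natRank (P M) =
      ∑ᶠ F : {F : Set α // M.IsFlat F}, charPoly (M ↾ (F : Set α)) * P (M ／ (F : Set α)))
    (M : Matroid α) (hM : M.Finite) : P M = klPoly M := by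
  induction hn : M.E.ncard using Nat.strong_induction_on generalizing M with
  | _ n ih =>
    subst hn
    rw [klPoly, dif_pos hM]
    by_cases hr : M.natRank = 0
    · rw [if_pos hr]
      split_ifs with hE
      · exact (h0 M hM hr).1 hE
      · exact (h0 M hM hr).2 hE
    · rw [if_neg hr]
      have hd := hdeg M hM (Nat.pos_of_ne_zero hr)
      have key : ∑ᶠ F : {F : Set α // M.IsFlat F ∧ F ≠ ∅},
            charPoly (M ↾ (F : Set α)) * klPoly (M ／ (F : Set α))
          = ∑ᶠ F : {F : Set α // M.IsFlat F ∧ F ≠ ∅},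
            charPoly (M ↾ (F : Set α)) * P (M ／ (F : Set α)) := by
        refine finsum_congr fun F => ?_
        rw [ih _ ?_ (M ／ (F : Set α)) inferInstance rfl]
        rw [contract_ground]
        refine Set.ncard_lt_ncard ?_ hM.ground_finite
        obtain ⟨x, hx⟩ := Set.nonempty_iff_ne_empty.2 F.2.2
        exact (Set.ssubset_iff_of_subset Set.sdiff_subset).2
          ⟨x, F.2.1.subset_ground hx, fun h => h.2 hx⟩
      rw [key]
      have hrecM := hrec M hM
      by_cases hfl : M.IsFlat ∅
      · rw [finsum_flats_split M ∅ hfl (fun F => charPoly (M ↾ F) * P (M ／ F)),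
          charPoly_eq_one _ (restrict_ground_eq), one_mul, contract_empty] at hrecM
        have h := congrArg (lowHalf M.natRank) hrecM
        rw [lowHalf_add, (lowHalf_reflect hd).1, (lowHalf_reflect hd).2] at h
        exact eq_neg_of_add_eq_zero_left h.symm
      · have hloop : ∃ e, M.IsLoop e := by
          by_contra hno
          push Not at hno
          refine hfl (isFlat_iff_closure_eq.2 ?_)
          exact Set.eq_empty_iff_forall_notMem.2 hno
        obtain ⟨e, he⟩ := hloop
        have hz : ∀ F : Set α, M.IsFlat F → charPoly (M ↾ F) = 0 := by
          intro F hF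
          have := restrict_finite (M := M) (hM.ground_finite.subset hF.subset_ground)
          refine charPoly_eq_zero_of_isLoop (M ↾ F) (e := e) ?_
          have heF : e ∈ F := he.mem_of_isFlat hF
          rw [← singleton_dep, restrict_dep_iff]
          exact ⟨(singleton_dep.2 he).not_indep, Set.singleton_subset_iff.2 heF⟩ 
        have e1 : ∑ᶠ F : {F : Set α // M.IsFlat F ∧ F ≠ ∅},
            charPoly (M ↾ (F : Set α)) * P (M ／ (F : Set α)) = 0 :=
          finsum_eq_zero_of_forall_eq_zero fun F => by rw [hz F F.2.1, zero_mul]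
        have e2 : ∑ᶠ F : {F : Set α // M.IsFlat F},
            charPoly (M ↾ (F : Set α)) * P (M ／ (F : Set α)) = 0 :=
          finsum_eq_zero_of_forall_eq_zero fun F => by rw [hz F F.2, zero_mul]
        rw [e2, Polynomial.reflect_eq_zero_iff] at hrecM
        rw [e1, hrecM]
        ext i
        simp [coeff_lowHalf]

theorem invKLPoly_unique {α : Type u} (Q : Matroid α → ℤ[X])
    (h0 : ∀ M : Matroid α, M.Finite → M.natRank = 0 →
      (M.E = ∅ → Q M = 1) ∧ (M.E ≠ ∅ → Q M = 0))
    (hdeg : ∀ M : Matroid α, M.Finite → 0 < M.natRank → 2 * (Q M).natDegree < M.natRank)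
    (hrec : ∀ M : Matroid α, M.Finite → (-1) ^ M.natRank * Polynomial.reflect M.natRank (Q M) =
      ∑ᶠ F : {F : Set α // M.IsFlat F}, (-1) ^ M.natRk F * Q (M ↾ (F : Set α)) *
        Polynomial.reflect (M.natRank - M.natRk F) (charPoly (M ／ (F : Set α))))
    (M : Matroid α) (hM : M.Finite) : Q M = invKLPoly M := by
  induction hn : M.E.ncard using Nat.strong_induction_on generalizing M with
  | _ n ih =>
    subst hn
    rw [invKLPoly, dif_pos hM]
    by_cases hr : M.natRank = 0
    · rw [if_pos hr]
      split_ifs with hE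
      · exact (h0 M hM hr).1 hE
      · exact (h0 M hM hr).2 hE
    · rw [if_neg hr]
      have hd := hdeg M hM (Nat.pos_of_ne_zero hr)
      have key : ∑ᶠ F : {F : Set α // M.IsFlat F ∧ F ≠ M.E},
            (-1) ^ M.natRk F * invKLPoly (M ↾ (F : Set α)) *
              Polynomial.reflect (M.natRank - M.natRk F) (charPoly (M ／ (F : Set α)))
          = ∑ᶠ F : {F : Set α // M.IsFlat F ∧ F ≠ M.E},
            (-1) ^ M.natRk F * Q (M ↾ (F : Set α)) *
              Polynomial.reflect (M.natRank - M.natRk F) (charPoly (M ／ (F : Set α))) := by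
        refine finsum_congr fun F => ?_
        rw [ih _ ?_ (M ↾ (F : Set α))
          (restrict_finite (hM.ground_finite.subset F.2.1.subset_ground)) rfl]
        rw [restrict_ground_eq]
        exact Set.ncard_lt_ncard (F.2.1.subset_ground.ssubset_of_ne F.2.2) hM.ground_finite
      rw [key]
      have hrecM := hrec M hM
      have hEE : M.natRk M.E = M.natRank := by rw [natRk, natRank, eRk_ground]
      rw [finsum_flats_split M M.E M.ground_isFlat (fun F => (-1) ^ M.natRk F * Q (M ↾ F) *
          Polynomial.reflect (M.natRank - M.natRk F) (charPoly (M ／ F))),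
        hEE, charPoly_eq_one (M ／ M.E) (by simp), restrict_ground_eq_self, Nat.sub_self,
        Polynomial.reflect_one, pow_zero, mul_one] at hrecM
      have hneg : ∀ R : ℤ[X], lowHalf M.natRank ((-1) ^ M.natRank * R)
          = (-1) ^ M.natRank * lowHalf M.natRank R := by
        intro R
        rcases neg_one_pow_eq_or ℤ[X] M.natRank with h | h <;> rw [h]
        · simp
        · ext i
          simp only [neg_mul, one_mul, Polynomial.coeff_neg, coeff_lowHalf]
          split_ifs <;> simp
      have h := congrArg (lowHalf M.natRank) hrecM
      rw [lowHalf_add, hneg, hneg, (lowHalf_reflect hd).1, (lowHalf_reflect hd).2, mul_zero] at h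
      have h2 := eq_neg_of_add_eq_zero_right h.symm
      rw [h2]
      have hsq : ((-1 : ℤ[X]) ^ M.natRank) * (-1) ^ M.natRank = 1 := by
        rw [← mul_pow]; simp
      linear_combination (-(Q M)) * hsq

end Matroid

universe v

/-! Contracting a set that is not a flat creates a loop, and a loop makes both `charPoly` and
`klPoly` vanish. The sums over flats that define the three polynomials can therefore be extended to
all subsets `A` of `E`. A matroid and its relaxation share this index set, so the sums can be
compared term by term.

Let `k` be the rank and `h` the size of `H`. If `h < k`, relaxation changes nothing. Otherwise
`IsStressedHyperplane.subset_cases` leaves five kinds of `A`: (1) `A ⊆ H` with fewer than `k`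
elements: `A` is independent, the restriction to it is Boolean in both matroids, and contracting `A`
commutes with relaxing (`relax_contract_of_subset`); (2) `A = H`: a flat of `M`, with `M ↾ H`
uniform of rank `k - 1` and `M ／ H` loopless of rank one, but no flat of the relaxation; (3) `A =
E`, which matters only through the change of `χ_M`; (4) `A` proper, not inside `H`, with fewer than
`k` elements in `H`: restriction and contraction agree; (5) all other `A`, which are flats of
neither matroid. Every nonzero difference depends only on `k`, `h` and the size of `A`, and the
subsets of `H` of a given size are counted by binomial coefficients. This gives `charPoly_relax`,
`klPoly_relax` (by induction on the rank), `invKLPoly_relax` and `zPoly_relax`.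

In a paving matroid every hyperplane is stressed, and a relaxation is again paving. Relaxing one
hyperplane with at least `k` elements removes it and creates no other of that size. When none is
left the matroid is uniform, and isomorphism invariance gives part (b), in the form
`IsPaving.eq_sub_sum`. -/

namespace Matroid

/-! ### Sums over all subsets of a set -/

/-- The sum of `g A` over all subsets `A` of `E`. -/
noncomputable def subsetSum {α : Type u} (E : Set α) (g : Set α → ℤ[X]) : ℤ[X] :=
  ∑ᶠ A : {A : Set α // A ⊆ E}, g A

theorem subsetSum_congr {α : Type u} {E : Set α} {g g' : Set α → ℤ[X]}
    (h : ∀ A ⊆ E, g A = g' A) : subsetSum E g = subsetSum E g' :=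
  finsum_congr fun A => h A A.2

theorem subsetSum_coe {α : Type u} [DecidableEq α] (S : Finset α) (g : Set α → ℤ[X]) :
    subsetSum (S : Set α) g = ∑ A ∈ S.powerset, g A := by
  have h1 : subsetSum (S : Set α) g = ∑ᶠ A ∈ {A : Set α | A ⊆ S}, g A :=
    finsum_set_coe_eq_finsum_mem {A : Set α | A ⊆ S}
  have h2 : {A : Set α | A ⊆ S} =
      (fun A : Finset α => (A : Set α)) '' (S.powerset : Set (Finset α)) := by
    ext A
    simp only [Set.mem_ofPred_eq, Set.mem_image, Finset.mem_coe, Finset.mem_powerset]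
    constructor
    · intro h
      have hf : A.Finite := S.finite_toSet.subset h
      exact ⟨hf.toFinset, by simpa [← Finset.coe_subset] using h, by simp⟩
    · rintro ⟨B, hB, rfl⟩
      exact_mod_cast hB
  rw [h1, h2, finsum_mem_image (Finset.coe_injective.injOn), finsum_mem_coe_finset]

theorem subsetSum_image {α : Type u} {β : Type v} {E : Set α} {f : α → β} (hf : Set.InjOn f E)
    (g : Set β → ℤ[X]) : subsetSum (f '' E) g = subsetSum E fun A => g (f '' A) := by
  refine (finsum_eq_of_bijective
    (fun A : {A : Set α // A ⊆ E} => (⟨f '' A, Set.image_mono A.2⟩ : {B : Set β // B ⊆ f '' E}))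
    ⟨?_, ?_⟩ fun A => rfl).symm
  · intro A B h
    exact Subtype.ext ((hf.image_eq_image_iff A.2 B.2).1 (congrArg Subtype.val h))
  · rintro ⟨B, hB⟩
    obtain ⟨A, hA, rfl⟩ := Set.subset_image_iff.1 hB
    exact ⟨⟨A, hA⟩, rfl⟩

/-- Serves to replace the flats, which change under relaxation, by all subsets of the ground set,
which do not. -/
theorem finsum_eq_subsetSum {α : Type u} {E : Set α} {p : Set α → Prop}
    {f g : Set α → ℤ[X]} (hp : ∀ A, p A → A ⊆ E) (h1 : ∀ A, p A → f A = g A)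
    (h0 : ∀ A ⊆ E, ¬ p A → g A = 0) :
    ∑ᶠ A : {A : Set α // p A}, f A = subsetSum E g := by
  have e1 : ∑ᶠ A : {A : Set α // p A}, f A = ∑ᶠ A ∈ {A : Set α | p A}, f A :=
    finsum_set_coe_eq_finsum_mem {A : Set α | p A}
  have e2 : subsetSum E g = ∑ᶠ A ∈ {A : Set α | A ⊆ E}, g A :=
    finsum_set_coe_eq_finsum_mem {A : Set α | A ⊆ E}
  rw [e1, e2, (finsum_mem_congr rfl h1 : ∑ᶠ A ∈ {A : Set α | p A}, f A = ∑ᶠ A ∈ {A | p A}, g A)]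
  refine finsum_mem_inter_support_eq _ _ _ ?_
  ext A
  simp only [Set.mem_inter_iff, Set.mem_ofPred_eq, Function.mem_support]
  exact ⟨fun h => ⟨hp A h.1, h.2⟩, fun h => ⟨by_contra fun hn => h.2 (h0 A h.1 hn), h.2⟩⟩

/-! ### The polynomials as sums over all subsets; rank of a contraction -/

section Basic

variable {α : Type u} {M : Matroid α}

theorem coe_natRank (M : Matroid α) [M.Finite] : (M.natRank : ℕ∞) = M.eRank :=
  ENat.natCast_toNat ((M.eRank_ne_top_iff).2 inferInstance)

theorem coe_natRk (M : Matroid α) [M.Finite] (A : Set α) : (M.natRk A : ℕ∞) = M.eRk A :=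
  ENat.natCast_toNat (ne_top_of_le_ne_top ((M.eRank_ne_top_iff).2 inferInstance) (M.eRk_le_eRank A))

theorem charPoly_eq_subsetSum (M : Matroid α) : charPoly M =
    subsetSum M.E fun A => (-1) ^ A.ncard * Polynomial.X ^ (M.natRank - M.natRk A) := rfl

/-- Any element of the closure of `F` outside `F` becomes a loop. -/
theorem exists_isLoop_contract {F : Set α} (hFE : F ⊆ M.E) (hF : ¬ M.IsFlat F) :
    ∃ e, (M ／ F).IsLoop e := by
  by_contra! hno
  refine hF (isFlat_iff_closure_eq.2 ((M.subset_closure F hFE).antisymm' fun e he => ?_))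
  by_contra heF
  exact hno e (contract_isLoop_iff_mem_closure.2 ⟨he, heF⟩)

/-- No induction is needed: a loop lies in every flat `F`, so each factor `charPoly (M ↾ F)` is
already zero. -/
theorem klPoly_eq_zero_of_isLoop [M.Finite] {e : α} (he : M.IsLoop e) : klPoly M = 0 := by
  rw [klPoly, dif_pos ‹_›]
  have hE : M.E ≠ ∅ := fun h => by simpa [h] using he.mem_ground
  rw [if_neg hE]
  split_ifs with h
  · rfl
  rw [finsum_eq_zero_of_forall_eq_zero]
  · ext i; simp [coeff_lowHalf]
  · intro F
    have hF := F.2.1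
    have := restrict_finite (M := M) (M.ground_finite.subset hF.subset_ground)
    rw [charPoly_eq_zero_of_isLoop (M ↾ (F : Set α)) (e := e), zero_mul]
    exact restrict_isLoop_iff.2 ⟨he.mem_of_isFlat hF, Or.inl he⟩

theorem klPoly_contract_eq_zero [M.Finite] {F : Set α} (hFE : F ⊆ M.E) (hF : ¬ M.IsFlat F) :
    klPoly (M ／ F) = 0 := by
  obtain ⟨e, he⟩ := exists_isLoop_contract hFE hF
  exact klPoly_eq_zero_of_isLoop he

theorem charPoly_contract_eq_zero [M.Finite] {F : Set α} (hFE : F ⊆ M.E) (hF : ¬ M.IsFlat F) :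
    charPoly (M ／ F) = 0 := by
  obtain ⟨e, he⟩ := exists_isLoop_contract hFE hF
  exact charPoly_eq_zero_of_isLoop _ he

open Classical in
theorem klPoly_eq_subsetSum (M : Matroid α) [M.Finite] (hM : M.natRank ≠ 0) : klPoly M =
    - lowHalf M.natRank (subsetSum M.E fun F =>
      if F = ∅ then 0 else charPoly (M ↾ F) * klPoly (M ／ F)) := by
  rw [klPoly, dif_pos ‹_›, if_neg hM]
  congr 2
  refine finsum_eq_subsetSum (f := fun F => charPoly (M ↾ F) * klPoly (M ／ F))
    (fun A h => h.1.subset_ground) (fun A h => by simp [h.2]) fun A hA h => ?_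
  split_ifs with h0
  · rfl
  · rw [klPoly_contract_eq_zero hA fun hF => h ⟨hF, h0⟩, mul_zero]

open Classical in
theorem invKLPoly_eq_subsetSum (M : Matroid α) [M.Finite] (hM : M.natRank ≠ 0) : invKLPoly M =
    - (-1) ^ M.natRank * lowHalf M.natRank (subsetSum M.E fun F =>
      if F = M.E then 0 else (-1) ^ M.natRk F * invKLPoly (M ↾ F) *
          Polynomial.reflect (M.natRank - M.natRk F) (charPoly (M ／ F))) := by
  rw [invKLPoly, dif_pos ‹_›, if_neg hM]
  congr 2
  refine finsum_eq_subsetSum (f := fun F => (-1) ^ M.natRk F * invKLPoly (M ↾ F) *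
          Polynomial.reflect (M.natRank - M.natRk F) (charPoly (M ／ F)))
    (fun A h => h.1.subset_ground) (fun A h => by simp [h.2]) fun A hA h => ?_
  split_ifs with h0
  · rfl
  · rw [charPoly_contract_eq_zero hA fun hF => h ⟨hF, h0⟩, Polynomial.reflect_zero, mul_zero]

theorem zPoly_eq_subsetSum (M : Matroid α) [M.Finite] : zPoly M =
    subsetSum M.E fun F => Polynomial.X ^ M.natRk F * klPoly (M ／ F) :=
  finsum_eq_subsetSum (f := fun F => Polynomial.X ^ M.natRk F * klPoly (M ／ F))
    (fun A h => h.subset_ground) (fun A h => rfl) fun A hA h => by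
      rw [klPoly_contract_eq_zero hA h, mul_zero]

/-- Fix a basis `I` of `C`. A base of `M ／ C` together with `I` is independent in `M`; conversely,
for a base `B ⊇ I` of `M`, the set `B \ I` is independent in `M ／ C`. -/
theorem eRank_contract_add_eRk (M : Matroid α) (C : Set α) :
    (M ／ C).eRank + M.eRk C = M.eRank := by
  obtain ⟨I, hI⟩ := M.exists_isBasis' C
  rw [hI.eRk_eq_encard]
  apply le_antisymm
  · obtain ⟨J, hJ⟩ := (M ／ C).exists_isBase
    obtain ⟨h1, h2⟩ := hI.contract_indep_iff.1 hJ.indep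
    rw [← hJ.encard_eq_eRank, ← Set.encard_union_eq (h2.symm.mono_right hI.subset)]
    exact h1.encard_le_eRank
  · obtain ⟨B, hB, hIB⟩ := hI.indep.exists_isBase_superset
    have hd : Disjoint C (B \ I) := by
      rw [Set.disjoint_left]
      exact fun e heC he => he.2 (hI.mem_of_insert_indep heC
        (hB.indep.subset (Set.insert_subset he.1 hIB)))
    rw [← hB.encard_eq_eRank, ← Set.encard_sdiff_add_encard_of_subset hIB]
    gcongr
    refine Indep.encard_le_eRank (hI.contract_indep_iff.2 ⟨?_, hd⟩)
    rw [Set.sdiff_union_of_subset hIB]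
    exact hB.indep

theorem natRank_contract_add_natRk (M : Matroid α) [M.Finite] (C : Set α) :
    (M ／ C).natRank + M.natRk C = M.natRank := by
  have := M.eRank_contract_add_eRk C
  rw [← coe_natRank, ← coe_natRank, ← coe_natRk] at this
  exact_mod_cast this

end Basic

/-! ### Invariance under isomorphism -/

section Map

variable {α : Type u} {β : Type v} {M : Matroid α} {f : α → β}

theorem natRank_map (hf : Set.InjOn f M.E) : (M.map f hf).natRank = M.natRank := by
  rw [natRank, natRank, eRank_map]

theorem natRk_map (hf : Set.InjOn f M.E) {A : Set α} (hA : A ⊆ M.E) :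
    (M.map f hf).natRk (f '' A) = M.natRk A := by
  rw [natRk, natRk, eRk_map _ hf hA]

theorem map_restrict (hf : Set.InjOn f M.E) {R : Set α} (hR : R ⊆ M.E) :
    M.map f hf ↾ (f '' R) = (M ↾ R).map f (hf.mono hR) := by
  refine ext_indep rfl fun I hI => ?_
  obtain ⟨J, hJ, rfl⟩ := Set.subset_image_iff.1 hI
  rw [restrict_indep_iff, map_image_indep_iff (hJ.trans hR),
    map_image_indep_iff (M := M ↾ R) hJ, restrict_indep_iff]
  simp [hJ, Set.image_mono hJ]

/-- Contraction is dual to deletion, and deletion is a restriction, so `map_restrict` applied to the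
dual suffices. -/
theorem map_contract (hf : Set.InjOn f M.E) {C : Set α} (hC : C ⊆ M.E) :
    M.map f hf ／ (f '' C) = (M ／ C).map f (hf.mono Set.sdiff_subset) := by
  have h : (M.map f hf)✶ ＼ (f '' C) = (M✶ ＼ C).map f (hf.mono Set.sdiff_subset) := by
    rw [map_dual]
    change M✶.map f hf ↾ (f '' M.E \ f '' C) = _
    rw [← hf.image_sdiff_subset hC]
    exact map_restrict (M := M✶) hf Set.sdiff_subset
  rw [← dual_delete_dual, h, map_dual]
  rfl

theorem charPoly_map (hf : Set.InjOn f M.E) : charPoly (M.map f hf) = charPoly M := by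
  rw [charPoly_eq_subsetSum, charPoly_eq_subsetSum, map_ground, subsetSum_image hf]
  refine subsetSum_congr fun A hA => ?_
  rw [natRank_map, natRk_map hf hA, (hf.mono hA).ncard_image]

theorem klPoly_map [hM : M.Finite] (hf : Set.InjOn f M.E) : klPoly (M.map f hf) = klPoly M := by
  induction hn : M.E.ncard using Nat.strong_induction_on generalizing M with
  | _ n ih =>
    subst hn
    by_cases hr : M.natRank = 0
    · rw [klPoly, klPoly, dif_pos hM, dif_pos (inferInstance : (M.map f hf).Finite), natRank_map,
        if_pos hr, if_pos hr]
      simp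
    · rw [klPoly_eq_subsetSum _ hr, klPoly_eq_subsetSum _ (by rwa [natRank_map]), natRank_map,
        map_ground, subsetSum_image hf]
      congr 2
      refine subsetSum_congr fun A hA => ?_
      by_cases h0 : A = ∅
      · simp [h0]
      rw [if_neg h0, if_neg (by simpa using h0), map_restrict hf hA, map_contract hf hA,
        charPoly_map, ih _ ?_ _ rfl]
      obtain ⟨x, hx⟩ := Set.nonempty_iff_ne_empty.2 h0
      exact Set.ncard_lt_ncard ((Set.ssubset_iff_of_subset Set.sdiff_subset).2
        ⟨x, hA hx, fun h => h.2 hx⟩) hM.ground_finite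

theorem invKLPoly_map [hM : M.Finite] (hf : Set.InjOn f M.E) :
    invKLPoly (M.map f hf) = invKLPoly M := by
  induction hn : M.E.ncard using Nat.strong_induction_on generalizing M with
  | _ n ih =>
    subst hn
    by_cases hr : M.natRank = 0
    · rw [invKLPoly, invKLPoly, dif_pos hM, dif_pos (inferInstance : (M.map f hf).Finite),
        natRank_map, if_pos hr, if_pos hr]
      simp
    · rw [invKLPoly_eq_subsetSum _ hr, invKLPoly_eq_subsetSum _ (by rwa [natRank_map]),
        natRank_map, map_ground, subsetSum_image hf]
      congr 2
      refine subsetSum_congr fun A hA => ?_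
      by_cases h0 : A = M.E
      · simp [h0]
      have := restrict_finite (M := M) (M.ground_finite.subset hA)
      rw [if_neg h0, if_neg (by rwa [hf.image_eq_image_iff hA subset_rfl]), map_restrict hf hA,
        map_contract hf hA, charPoly_map, natRk_map hf hA, ih _ ?_ _ rfl]
      exact Set.ncard_lt_ncard (hA.ssubset_of_ne h0) hM.ground_finite

theorem zPoly_map [M.Finite] (hf : Set.InjOn f M.E) : zPoly (M.map f hf) = zPoly M := by
  rw [zPoly_eq_subsetSum, zPoly_eq_subsetSum, map_ground, subsetSum_image hf]
  refine subsetSum_congr fun A hA => ?_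
  rw [natRk_map hf hA, map_contract hf hA, klPoly_map]

end Map

theorem Indep.natRk_eq_ncard {α : Type u} {M : Matroid α} {I : Set α} (hI : M.Indep I) :
    M.natRk I = I.ncard := by
  rw [natRk, hI.eRk_eq_encard]; rfl

theorem IsStressedHyperplane.subset_ground {α : Type u} {M : Matroid α} {H : Set α}
    (hH : M.IsStressedHyperplane H) : H ⊆ M.E :=
  hH.1.1.subset_ground

/-! ### Ranks as natural numbers -/

section Rank

variable {α : Type u} {M : Matroid α} [M.Finite] {A B I : Set α}

theorem encard_eq_eRank_iff (hA : A ⊆ M.E) : A.encard = M.eRank ↔ A.ncard = M.natRank := by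
  rw [← (M.ground_finite.subset hA).cast_ncard_eq, ← coe_natRank, Nat.cast_inj]

theorem Indep.ncard_le_natRank (hI : M.Indep I) : I.ncard ≤ M.natRank := by
  have := hI.encard_le_eRank
  rw [← coe_natRank, ← (M.ground_finite.subset hI.subset_ground).cast_ncard_eq] at this
  exact_mod_cast this

theorem natRk_mono (M : Matroid α) [M.Finite] (h : A ⊆ B) : M.natRk A ≤ M.natRk B := by
  have := M.eRk_mono h
  rw [← coe_natRk, ← coe_natRk] at this
  exact_mod_cast this

theorem natRk_le_natRank (M : Matroid α) [M.Finite] (A : Set α) : M.natRk A ≤ M.natRank := by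
  have := M.eRk_le_eRank A
  rw [← coe_natRk, ← coe_natRank] at this
  exact_mod_cast this

theorem closure_eq_closure_of_natRk_le (hA : A ⊆ M.E) (h : A ⊆ B) (hr : M.natRk B ≤ M.natRk A) :
    M.closure A = M.closure B := by
  refine (M.isRkFinite_of_finite
    (M.ground_finite.subset hA)).closure_eq_closure_of_subset_of_eRk_ge_eRk h ?_
  rw [← coe_natRk, ← coe_natRk]
  exact_mod_cast hr

theorem natRk_insert_of_notMem_closure {e : α} (he : e ∈ M.E) (heA : e ∉ M.closure A) :
    M.natRk (insert e A) = M.natRk A + 1 := by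
  have := M.eRk_insert_eq_add_one ⟨he, heA⟩
  rw [← coe_natRk, ← coe_natRk] at this
  exact_mod_cast this

theorem natRk_ground (M : Matroid α) : M.natRk M.E = M.natRank := by
  rw [natRk, natRank, eRk_ground]

theorem closure_eq_ground_of_natRk_eq (hA : A ⊆ M.E) (h : M.natRk A = M.natRank) :
    M.closure A = M.E := by
  rw [closure_eq_closure_of_natRk_le hA hA (by rw [h, natRk_ground]), closure_ground]

theorem not_isFlat_of_natRk_eq (hA : A ⊆ M.E) (hne : A ≠ M.E) (h : M.natRk A = M.natRank) :
    ¬ M.IsFlat A := fun hf =>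
  hne (by rw [← hf.closure, closure_eq_ground_of_natRk_eq hA h])

/-- This is `eRank_contract_add_eRk` inside the restriction to `X ∪ C`. -/
theorem eRk_contract_add_eRk (M : Matroid α) {C X : Set α} (h : Disjoint C X) :
    (M ／ C).eRk X + M.eRk C = M.eRk (X ∪ C) := by
  have := eRank_contract_add_eRk (M ↾ (X ∪ C)) C
  rwa [← contract_restrict_eq_restrict_contract M h, eRank_restrict, eRank_restrict,
    restrict_eRk_eq _ Set.subset_union_right] at this

theorem restrict_finite_of_subset (M : Matroid α) [M.Finite] (hA : A ⊆ M.E) : (M ↾ A).Finite :=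
  restrict_finite (M.ground_finite.subset hA)

end Rank

/-! ### Stressed hyperplanes -/

section Stressed

variable {α : Type u} {M : Matroid α} [M.Finite] {H A F : Set α}

theorem IsHyperplane.natRk_add_one (hH : M.IsHyperplane H) : M.natRk H + 1 = M.natRank := by
  have := hH.2
  rw [← coe_natRk, ← coe_natRank] at this
  exact_mod_cast this

theorem IsStressedHyperplane.natRk_add_one (hH : M.IsStressedHyperplane H) :
    M.natRk H + 1 = M.natRank := hH.1.natRk_add_one

theorem IsStressedHyperplane.isCircuit (hH : M.IsStressedHyperplane H) (hA : A ⊆ H)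
    (h : A.ncard = M.natRank) : M.IsCircuit A :=
  hH.2 A hA ((encard_eq_eRank_iff (hA.trans hH.subset_ground)).2 h)

theorem IsStressedHyperplane.ne_ground (hH : M.IsStressedHyperplane H) : H ≠ M.E := by
  intro h
  have := hH.natRk_add_one
  rw [h, natRk_ground] at this
  omega

theorem IsStressedHyperplane.finite (hH : M.IsStressedHyperplane H) : H.Finite :=
  M.ground_finite.subset hH.subset_ground

/-- Small subsets of a stressed hyperplane are independent. -/
theorem IsStressedHyperplane.indep (hH : M.IsStressedHyperplane H) (hk : M.natRank ≤ H.ncard)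
    (hA : A ⊆ H) (h : A.ncard < M.natRank) : M.Indep A := by
  -- Enlarge `A` to a `k`-subset of `H`; this is a circuit, and `A` is a proper subset of it.
  obtain ⟨S, hAS, hSH, hS⟩ := Set.exists_subsuperset_card_eq hA h.le hk
  exact (hH.isCircuit hSH hS).ssubset_indep (hAS.ssubset_of_ne (by rintro rfl; omega))

theorem IsStressedHyperplane.natRk_of_le (hH : M.IsStressedHyperplane H) (hA : A ⊆ H)
    (h : M.natRank ≤ A.ncard) : M.natRk A + 1 = M.natRank := by
  obtain ⟨S, hSA, hS⟩ := Set.exists_subset_card_eq h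
  have hc := (hH.isCircuit (hSA.trans hA) hS).eRk_add_one_eq
  rw [← coe_natRk, (encard_eq_eRank_iff ((hSA.trans hA).trans hH.subset_ground)).2 hS,
    ← coe_natRank] at hc
  have hc' : M.natRk S + 1 = M.natRank := by exact_mod_cast hc
  have h1 := M.natRk_mono hSA
  have h2 := M.natRk_mono hA
  have h3 := hH.natRk_add_one
  omega

theorem IsStressedHyperplane.closure_of_le (hH : M.IsStressedHyperplane H) (hA : A ⊆ H)
    (h : M.natRank ≤ A.ncard) : M.closure A = H := by
  have h1 := hH.natRk_of_le hA h
  have h2 := hH.natRk_add_one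
  rw [closure_eq_closure_of_natRk_le (hA.trans hH.subset_ground) hA (by omega), hH.1.1.closure]

/-- The part of `A` in `H` already spans `H`, and any element of `A` off `H` raises the rank by one.
-/
theorem IsStressedHyperplane.natRk_of_inter (hH : M.IsStressedHyperplane H) (hAE : A ⊆ M.E)
    (hA : ¬ A ⊆ H) (h : M.natRank ≤ (A ∩ H).ncard) : M.natRk A = M.natRank := by
  obtain ⟨e, he, heH⟩ := Set.not_subset.1 hA
  have h1 := hH.natRk_of_le Set.inter_subset_right h
  have h2 := hH.closure_of_le Set.inter_subset_right h
  have h3 := natRk_insert_of_notMem_closure (M := M) (A := A ∩ H) (hAE he) (by rwa [h2])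
  have h4 := M.natRk_mono (Set.insert_subset he (Set.inter_subset_left (s := A) (t := H)))
  have h5 := M.natRk_le_natRank A
  omega

/-- If `S ⊆ H \ F` has `k - |F|` elements, then `S ∪ F` is a circuit of `M`, and contracting its
proper subset `F` leaves the circuit `S`. -/
theorem IsStressedHyperplane.contract (hH : M.IsStressedHyperplane H)
    (hk : M.natRank ≤ H.ncard) (hF : F ⊆ H) (h : F.ncard < M.natRank) :
    (M ／ F).IsStressedHyperplane (H \ F) := by
  have hFi := hH.indep hk hF h
  have hr := natRank_contract_add_natRk M F
  rw [hFi.natRk_eq_ncard] at hr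
  refine ⟨⟨?_, ?_⟩, fun S hS hSc => ?_⟩
  · rw [isFlat_iff_closure_eq, contract_closure_eq, Set.sdiff_union_of_subset hF, hH.1.1.closure]
  · have h1 := eRk_contract_add_eRk M (C := F) (X := H \ F) Set.disjoint_sdiff_right
    have h2 := natRank_contract_add_natRk M F
    have h3 := hH.natRk_add_one
    rw [Set.sdiff_union_of_subset hF, ← coe_natRk, ← coe_natRk, ← coe_natRk] at h1
    rw [← coe_natRk, ← coe_natRank]
    norm_cast at h1 ⊢
    omega
  · have hSE : S ⊆ (M ／ F).E := hS.trans (Set.sdiff_subset_sdiff_left hH.subset_ground)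
    rw [encard_eq_eRank_iff hSE] at hSc
    have hd : Disjoint S F := Set.disjoint_of_subset_left hS Set.disjoint_sdiff_left
    have hSf : S.Finite := hH.finite.subset (hS.trans Set.sdiff_subset)
    have hu : (S ∪ F).ncard = M.natRank := by
      rw [Set.ncard_union_eq hd hSf (hH.finite.subset hF)]; omega
    have hc := hH.isCircuit (Set.union_subset (hS.trans Set.sdiff_subset) hF) hu
    have hss : F ⊂ S ∪ F := Set.subset_union_right.ssubset_of_ne
      (by intro h'; rw [← h'] at hu; omega)
    have := hc.contract_isCircuit hss
    rwa [Set.union_sdiff_right, hd.sdiff_eq_left] at this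

end Stressed

/-! ### Independence, rank and minors of a relaxation -/

section Relax

variable {α : Type u} {M : Matroid α} [M.Finite] {H A F I : Set α}
  (hH : M.IsStressedHyperplane H)

@[simp] theorem relax_ground : (M.relax hH).E = M.E := rfl

instance relax_finite : (M.relax hH).Finite := ⟨M.ground_finite⟩

/-- A proper subset of a new base is a proper subset of a circuit of `M`, hence already independent.
Only the new bases themselves are new independent sets. -/
theorem relax_indep_iff :
    (M.relax hH).Indep I ↔ M.Indep I ∨ (I ⊆ H ∧ I.ncard = M.natRank) := by
  constructor
  · intro h
    obtain ⟨B, hB, hIB⟩ := h.exists_isBase_superset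
    rcases hB with hB | ⟨hBH, hBc⟩
    · exact Or.inl (hB.indep.subset hIB)
    · rw [encard_eq_eRank_iff (hBH.trans hH.subset_ground)] at hBc
      rcases eq_or_ne I B with rfl | hne
      · exact Or.inr ⟨hBH, hBc⟩
      · exact Or.inl ((hH.isCircuit hBH hBc).ssubset_indep (hIB.ssubset_of_ne hne))
  · rintro (h | ⟨hIH, hc⟩)
    · obtain ⟨B, hB, hIB⟩ := h.exists_isBase_superset
      exact IsBase.indep (M := M.relax hH) (Or.inl hB) |>.subset hIB
    · exact IsBase.indep (M := M.relax hH)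
        (Or.inr ⟨hIH, (encard_eq_eRank_iff (hIH.trans hH.subset_ground)).2 hc⟩)

theorem relax_eRank : (M.relax hH).eRank = M.eRank := by
  obtain ⟨B, hB⟩ := M.exists_isBase
  rw [← hB.encard_eq_eRank]
  exact (IsBase.encard_eq_eRank (M := M.relax hH) (Or.inl hB)).symm

theorem relax_natRank : (M.relax hH).natRank = M.natRank := by
  rw [natRank, natRank, relax_eRank]

theorem relax_restrict (hA : (A ∩ H).ncard < M.natRank) : M.relax hH ↾ A = M ↾ A := by
  refine ext_indep rfl fun I hI => ?_
  rw [restrict_indep_iff, restrict_indep_iff, relax_indep_iff]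
  refine and_congr_left fun hIA => or_iff_left ?_
  rintro ⟨hIH, hc⟩
  have := Set.ncard_le_ncard (Set.subset_inter hIA hIH)
    (hH.finite.subset Set.inter_subset_right)
  omega

theorem natRk_relax_of_subset (hA : A ⊆ H) (h : M.natRank ≤ A.ncard) :
    (M.relax hH).natRk A = M.natRank := by
  obtain ⟨S, hSA, hS⟩ := Set.exists_subset_card_eq h
  have h1 : (M.relax hH).Indep S := (relax_indep_iff hH).2 (Or.inr ⟨hSA.trans hA, hS⟩)
  have h2 := (M.relax hH).natRk_mono hSA
  have h3 := (M.relax hH).natRk_le_natRank A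
  rw [h1.natRk_eq_ncard] at h2
  rw [relax_natRank] at h3
  omega

theorem natRk_relax_of_not_subset (hAE : A ⊆ M.E) (hA : ¬ A ⊆ H) :
    (M.relax hH).natRk A = M.natRk A := by
  by_cases h : (A ∩ H).ncard < M.natRank
  · rw [natRk, ← eRank_restrict, relax_restrict hH h]; rfl
  · rw [not_lt] at h
    have h1 := natRk_relax_of_subset hH Set.inter_subset_right h
    have h2 := (M.relax hH).natRk_mono (Set.inter_subset_left (s := A) (t := H))
    have h3 := (M.relax hH).natRk_le_natRank A
    rw [relax_natRank] at h3
    rw [hH.natRk_of_inter hAE hA h]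
    omega

theorem natRk_relax_of_lt (hA : (A ∩ H).ncard < M.natRank) :
    (M.relax hH).natRk A = M.natRk A := by
  rw [natRk, ← eRank_restrict, relax_restrict hH hA]; rfl

/-- Since the rank of `F` does not change, a basis `I` of `F` stays one. A new independent set `J ∪
I` would lie in `H`, and then `F ⊆ closure I ⊆ H`. -/
theorem relax_contract_of_not_subset (hFE : F ⊆ M.E) (hF : ¬ F ⊆ H) :
    M.relax hH ／ F = M ／ F := by
  obtain ⟨I, hI⟩ := M.exists_isBasis F
  have hI' : (M.relax hH).IsBasis I F := by
    have hi : (M.relax hH).Indep I := (relax_indep_iff hH).2 (Or.inl hI.indep)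
    refine hi.isBasis_of_eRk_ge (M.ground_finite.subset hI.indep.subset_ground) hI.subset ?_
    rw [hi.eRk_eq_encard, hI.encard_eq_eRk, ← coe_natRk, ← coe_natRk,
      natRk_relax_of_not_subset hH hFE hF]
  refine ext_indep rfl fun J _ => ?_
  rw [hI.contract_indep_iff, hI'.contract_indep_iff, relax_indep_iff]
  refine and_congr_left fun _ => or_iff_left fun h => hF ?_
  refine hI.subset_closure.trans ?_
  rw [← hH.1.1.closure]
  exact M.closure_subset_closure (Set.subset_union_right.trans h.1)

theorem relax_contract_of_subset (hk : M.natRank ≤ H.ncard) (hF : F ⊆ H)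
    (h : F.ncard < M.natRank) :
    M.relax hH ／ F = (M ／ F).relax (hH.contract hk hF h) := by
  have hFi := hH.indep hk hF h
  have hFi' : (M.relax hH).Indep F := (relax_indep_iff hH).2 (Or.inl hFi)
  have hr := natRank_contract_add_natRk M F
  rw [hFi.natRk_eq_ncard] at hr
  refine ext_indep rfl fun J hJ => ?_
  rw [relax_indep_iff, hFi'.contract_indep_iff, hFi.contract_indep_iff, relax_indep_iff]
  have hJ' : J ⊆ M.E \ F := hJ
  have hd : Disjoint J F := Set.disjoint_of_subset_left hJ' Set.disjoint_sdiff_left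
  have hc : (J ∪ F).ncard = J.ncard + F.ncard :=
    Set.ncard_union_eq hd (M.ground_finite.subset (hJ'.trans Set.sdiff_subset))
      (hH.finite.subset hF)
  have e1 : J ∪ F ⊆ H ↔ J ⊆ H \ F := by
    rw [Set.union_subset_iff, Set.subset_sdiff]
    simp [hF, hd]
  rw [e1, hc]
  simp only [hd, true_and]
  refine or_congr_right (and_congr_right fun _ => ?_)
  omega

theorem relax_eq_self (hk : H.ncard < M.natRank) : M.relax hH = M := by
  refine ext_indep rfl fun I _ => ?_
  rw [relax_indep_iff]
  refine or_iff_left ?_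
  rintro ⟨hIH, hc⟩
  have := Set.ncard_le_ncard hIH hH.finite
  omega

end Relax

/-! ### Recognizing uniform matroids -/

section Uniform

variable {α : Type u} {M : Matroid α} [M.Finite]

theorem exists_eq_map_uniform {k n : ℕ} (hn : M.E.ncard = n)
    (h : ∀ I ⊆ M.E, M.Indep I ↔ I.ncard ≤ k) :
    ∃ (f : Fin n → α) (hf : Set.InjOn f (uniform k n).E), M = (uniform k n).map f hf := by
  have : Finite M.E := M.ground_finite.to_subtype
  let e : M.E ≃ Fin n := Finite.equivFinOfCardEq hn
  have hinj : Function.Injective (fun i => (e.symm i : α)) :=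
    Subtype.val_injective.comp e.symm.injective
  have hE : M.E = (fun i => (e.symm i : α)) '' (uniform k n).E := by
    change M.E = _ '' Set.univ
    rw [Set.image_univ]
    ext x
    refine ⟨fun hx => ⟨e ⟨x, hx⟩, by simp⟩, ?_⟩
    rintro ⟨i, rfl⟩
    exact (e.symm i).2
  refine ⟨fun i => e.symm i, hinj.injOn, ext_indep hE fun I hI => ?_⟩
  obtain ⟨J, hJ, rfl⟩ := Set.subset_image_iff.1 (hE ▸ hI)
  rw [h _ hI, map_image_indep_iff hJ, uniform_indep_iff, hinj.injOn.ncard_image]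

theorem charPoly_eq_uniform {k n : ℕ} (hn : M.E.ncard = n)
    (h : ∀ I ⊆ M.E, M.Indep I ↔ I.ncard ≤ k) : charPoly M = charPoly (uniform k n) := by
  obtain ⟨f, hf, rfl⟩ := exists_eq_map_uniform hn h
  exact charPoly_map hf

theorem klPoly_eq_uniform {k n : ℕ} (hn : M.E.ncard = n)
    (h : ∀ I ⊆ M.E, M.Indep I ↔ I.ncard ≤ k) : klPoly M = klPoly (uniform k n) := by
  obtain ⟨f, hf, rfl⟩ := exists_eq_map_uniform hn h
  exact klPoly_map hf

theorem invKLPoly_eq_uniform {k n : ℕ} (hn : M.E.ncard = n)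
    (h : ∀ I ⊆ M.E, M.Indep I ↔ I.ncard ≤ k) : invKLPoly M = invKLPoly (uniform k n) := by
  obtain ⟨f, hf, rfl⟩ := exists_eq_map_uniform hn h
  exact invKLPoly_map hf

theorem zPoly_eq_uniform {k n : ℕ} (hn : M.E.ncard = n)
    (h : ∀ I ⊆ M.E, M.Indep I ↔ I.ncard ≤ k) : zPoly M = zPoly (uniform k n) := by
  obtain ⟨f, hf, rfl⟩ := exists_eq_map_uniform hn h
  exact zPoly_map hf

end Uniform

/-! ### Evaluating sums over subsets -/

section SubsetSum

variable {α : Type u} {E B : Set α}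

theorem subsetSum_add (hE : E.Finite) (g g' : Set α → ℤ[X]) :
    subsetSum E (fun A => g A + g' A) = subsetSum E g + subsetSum E g' := by
  classical
  lift E to Finset α using hE
  simp only [subsetSum_coe, Finset.sum_add_distrib]

open Classical in
theorem subsetSum_ite_eq (hE : E.Finite) (hB : B ⊆ E) (c : ℤ[X]) :
    subsetSum E (fun A => if A = B then c else 0) = c := by
  lift E to Finset α using hE
  lift B to Finset α using E.finite_toSet.subset hB
  simp only [subsetSum_coe, Finset.coe_inj, Finset.sum_ite_eq', Finset.mem_powerset]
  rw [if_pos (by exact_mod_cast hB)]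

open Classical in
/-- Summing a function of the cardinality over the subsets of `B ⊆ E`. -/
theorem subsetSum_ite_subset (hE : E.Finite) (hB : B ⊆ E) (w : ℕ → ℤ[X]) :
    subsetSum E (fun A => if A ⊆ B then w A.ncard else 0) =
      ∑ j ∈ Finset.range (B.ncard + 1), B.ncard.choose j • w j := by
  lift E to Finset α using hE
  lift B to Finset α using E.finite_toSet.subset hB
  simp only [subsetSum_coe, Finset.coe_subset, Set.ncard_coe_finset]
  rw [← Finset.sum_powerset_apply_card, ← Finset.sum_filter]
  congr 1
  ext A
  simp only [Finset.mem_filter, Finset.mem_powerset]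
  exact ⟨fun h => h.2, fun h => ⟨h.trans (by exact_mod_cast hB), h⟩⟩

end SubsetSum

/-! ### Loopless matroids of rank one -/

section RankOne

theorem ground_nonempty_of_natRank_ne_zero {α : Type u} {M : Matroid α} (h : M.natRank ≠ 0) :
    M.E.Nonempty := by
  rw [Set.nonempty_iff_ne_empty]
  intro hE
  rw [← natRk_ground, hE, natRk, eRk_empty] at h
  exact h rfl

variable {α : Type u} {M : Matroid α} [M.Finite]

theorem natRk_eq_one_of_nonempty (h1 : M.natRank = 1) (hl : ∀ e, ¬ M.IsLoop e) {A : Set α}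
    (hA : A ⊆ M.E) (hne : A.Nonempty) : M.natRk A = 1 := by
  obtain ⟨e, he⟩ := hne
  have h : M.Indep {e} := indep_singleton.2 ((not_isLoop_iff (hA he)).1 (hl e))
  have h2 := M.natRk_mono (Set.singleton_subset_iff.2 he)
  rw [h.natRk_eq_ncard, Set.ncard_singleton] at h2
  have h3 := M.natRk_le_natRank A
  omega

theorem klPoly_contract_ground (M : Matroid α) [hM : M.Finite] : klPoly (M ／ M.E) = 1 := by
  have h := natRank_contract_add_natRk M M.E
  rw [natRk_ground, Nat.add_eq_right] at h
  rw [klPoly, dif_pos (inferInstance : (M ／ M.E).Finite), if_pos h, if_pos (by simp)]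

theorem charPoly_of_natRank_eq_one (h1 : M.natRank = 1) (hl : ∀ e, ¬ M.IsLoop e) :
    charPoly M = Polynomial.X - 1 := by
  classical
  have hne := ground_nonempty_of_natRank_ne_zero (M := M) (by omega)
  -- All nonempty sets have rank one, so only `A = ∅` deviates from the alternating sum,
  -- contributing `X` instead of `1`; the alternating sum is zero.
  have hterm : charPoly M = subsetSum M.E fun A =>
      (-1) ^ A.ncard + if A = ∅ then Polynomial.X - 1 else 0 := by
    rw [charPoly_eq_subsetSum]
    refine subsetSum_congr fun A hA => ?_
    rcases A.eq_empty_or_nonempty with rfl | hA'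
    · simp [h1, natRk]
    · rw [natRk_eq_one_of_nonempty h1 hl hA hA', h1, if_neg hA'.ne_empty]
      simp
  rw [hterm, subsetSum_add M.ground_finite, subsetSum_ite_eq M.ground_finite (Set.empty_subset _)]
  have hz : subsetSum M.E (fun A => (-1) ^ A.ncard) = 0 := by
    obtain ⟨S, hS⟩ : ∃ S : Finset α, (S : Set α) = M.E := ⟨_, M.ground_finite.coe_toFinset⟩
    have hS' : S.Nonempty := by rwa [← Finset.coe_nonempty, hS]
    rw [← hS, subsetSum_coe]
    simp only [Set.ncard_coe_finset]
    have := congrArg (Int.cast : ℤ → ℤ[X]) (Finset.sum_powerset_neg_one_pow_card_of_nonempty hS')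
    push_cast at this
    exact this
  rw [hz, zero_add]

theorem klPoly_of_natRank_eq_one (h1 : M.natRank = 1) (hl : ∀ e, ¬ M.IsLoop e) :
    klPoly M = 1 := by
  classical
  have hne := ground_nonempty_of_natRank_ne_zero (M := M) (by omega)
  rw [klPoly_eq_subsetSum M (by omega)]
  -- The only nonempty flat is `E`, and the part of `X - 1` of degree below `1/2` is its constant
  -- term.
  have hterm : (subsetSum M.E fun F =>
      if F = ∅ then 0 else charPoly (M ↾ F) * klPoly (M ／ F)) =
      subsetSum M.E fun F => if F = M.E then Polynomial.X - 1 else 0 := by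
    refine subsetSum_congr fun A hA => ?_
    rcases A.eq_empty_or_nonempty with rfl | hA'
    · rw [if_pos rfl, if_neg hne.ne_empty.symm]
    rw [if_neg hA'.ne_empty]
    split_ifs with h
    · rw [h, restrict_ground_eq_self, klPoly_contract_ground, mul_one,
        charPoly_of_natRank_eq_one h1 hl]
    · rw [klPoly_contract_eq_zero hA, mul_zero]
      exact not_isFlat_of_natRk_eq hA h (by rw [h1, natRk_eq_one_of_nonempty h1 hl hA hA'])
  rw [hterm, subsetSum_ite_eq M.ground_finite subset_rfl, h1]
  ext i
  simp only [Polynomial.coeff_neg, coeff_lowHalf, Polynomial.coeff_sub, Polynomial.coeff_X,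
    Polynomial.coeff_one]
  rcases i with _ | i <;> simp

variable {H : Set α}

theorem IsStressedHyperplane.natRank_contract_self (hH : M.IsStressedHyperplane H) :
    (M ／ H).natRank = 1 := by
  have h1 := natRank_contract_add_natRk M H
  have h2 := hH.natRk_add_one
  omega

theorem IsFlat.not_isLoop_contract {M : Matroid α} {F : Set α} (hF : M.IsFlat F) (e : α) :
    ¬ (M ／ F).IsLoop e := by
  rw [contract_isLoop_iff_mem_closure, hF.closure]
  exact fun h => h.2 h.1

end RankOne

/-! ### The correction polynomials and part (a) -/

section Difference

/-- The difference of the characteristic polynomials of a relaxation and of the original matroid,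
where the rank is `k` and the stressed hyperplane has `h` elements. -/
noncomputable def relaxCharPoly (k h : ℕ) : ℤ[X] :=
  ∑ j ∈ Finset.range (h + 1),
    h.choose j • if k ≤ j then (-1) ^ j * (1 - Polynomial.X) else 0

/-- The difference of the Kazhdan--Lusztig polynomials of a relaxation and of the original
matroid. -/
noncomputable def relaxKLPoly (k h : ℕ) : ℤ[X] :=
  -- The three summands are the contributions of `A = E`, of the nonempty `A ⊆ H` with fewer than
  -- `k` elements, and of `A = H`.
  if h < k then 0 else - lowHalf k (relaxCharPoly k h +
    ∑ j ∈ Finset.range (h + 1), h.choose j •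
      (if _hj : 0 < j ∧ j < k then charPoly (uniform j j) * relaxKLPoly (k - j) (h - j) else 0) +
    - charPoly (uniform (k - 1) h))
termination_by k

/-- The difference of the inverse Kazhdan--Lusztig polynomials of a relaxation and of the original
matroid. -/
noncomputable def relaxInvKLPoly (k h : ℕ) : ℤ[X] :=
  -- Here `A = E` is excluded from the recursion, while `A = ∅` contributes, so `j = 0` is allowed.
  if h < k then 0 else - (-1) ^ k * lowHalf k (
    ∑ j ∈ Finset.range (h + 1), h.choose j •
      (if j < k then (-1) ^ j * invKLPoly (uniform j j) *
        Polynomial.reflect (k - j) (relaxCharPoly (k - j) (h - j)) else 0) +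
    - ((-1) ^ (k - 1) * invKLPoly (uniform (k - 1) h) *
        Polynomial.reflect 1 (Polynomial.X - 1)))

/-- The difference of the `Z`-polynomials of a relaxation and of the original matroid. -/
noncomputable def relaxZPoly (k h : ℕ) : ℤ[X] :=
  if h < k then 0 else
    ∑ j ∈ Finset.range (h + 1), h.choose j •
      (if j < k then Polynomial.X ^ j * relaxKLPoly (k - j) (h - j) else 0) +
    - Polynomial.X ^ (k - 1)

variable {α : Type u} {M : Matroid α} [M.Finite] {H A : Set α}

/-- Only the subsets of `H` with at least `k` elements change rank, from `k - 1` to `k`, so their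
power of `X` drops from `X` to `1`. -/
theorem charPoly_relax (hH : M.IsStressedHyperplane H) :
    charPoly (M.relax hH) = charPoly M + relaxCharPoly M.natRank H.ncard := by
  classical
  rw [relaxCharPoly, ← subsetSum_ite_subset M.ground_finite hH.subset_ground
    (fun j => if M.natRank ≤ j then (-1) ^ j * (1 - Polynomial.X) else 0), charPoly_eq_subsetSum,
    charPoly_eq_subsetSum, relax_ground, ← subsetSum_add M.ground_finite]
  refine subsetSum_congr fun A hA => ?_
  rw [relax_natRank]
  by_cases hAH : A ⊆ H
  · rw [if_pos hAH]
    split_ifs with h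
    · have h1 := hH.natRk_of_le hAH h
      rw [natRk_relax_of_subset hH hAH h, ← h1]
      simp
      ring
    · rw [natRk_relax_of_lt hH (by rwa [Set.inter_eq_left.2 hAH, ← not_le]), add_zero]
  · rw [if_neg hAH, natRk_relax_of_not_subset hH hA hAH, add_zero]

/-- Case distinction for comparing the contributions of `A` to a matroid and to its relaxation. -/
theorem IsStressedHyperplane.subset_cases (hH : M.IsStressedHyperplane H) (hA : A ⊆ M.E) :
    (A ⊆ H ∧ A.ncard < M.natRank) ∨ A = H ∨ A = M.E ∨
    (¬ A ⊆ H ∧ A ≠ M.E ∧ (A ∩ H).ncard < M.natRank) ∨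
    ((A ⊆ H → M.natRank ≤ A.ncard) ∧ A ≠ H ∧ A ≠ M.E ∧ ¬ M.IsFlat A ∧
      ¬ (M.relax hH).IsFlat A) := by
  by_cases hAH : A ⊆ H
  · by_cases hc : A.ncard < M.natRank
    · exact Or.inl ⟨hAH, hc⟩
    rw [not_lt] at hc
    by_cases hne : A = H
    · exact Or.inr (Or.inl hne)
    have hE : A ≠ M.E := fun h => hH.ne_ground (hH.subset_ground.antisymm (h ▸ hAH))
    refine Or.inr (Or.inr (Or.inr (Or.inr ⟨fun _ => hc, hne, hE, fun h => ?_, ?_⟩)))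
    · rw [isFlat_iff_closure_eq, hH.closure_of_le hAH hc] at h
      exact hne h.symm
    · exact not_isFlat_of_natRk_eq (M := M.relax hH) hA hE
        (by rw [natRk_relax_of_subset hH hAH hc, relax_natRank])
  · have hne : A ≠ H := fun h => hAH h.subset
    by_cases hE : A = M.E
    · exact Or.inr (Or.inr (Or.inl hE))
    by_cases hc : (A ∩ H).ncard < M.natRank
    · exact Or.inr (Or.inr (Or.inr (Or.inl ⟨hAH, hE, hc⟩)))
    rw [not_lt] at hc
    have hr := hH.natRk_of_inter hA hAH hc
    exact Or.inr (Or.inr (Or.inr (Or.inr ⟨fun h => absurd h hAH, hne, hE,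
      not_isFlat_of_natRk_eq hA hE hr, not_isFlat_of_natRk_eq (M := M.relax hH) hA hE
        (by rw [natRk_relax_of_not_subset hH hA hAH, hr, relax_natRank])⟩)))

/-- `H` now contains a base, so it is a proper spanning set. -/
theorem IsStressedHyperplane.not_isFlat_relax (hH : M.IsStressedHyperplane H)
    (hk : M.natRank ≤ H.ncard) : ¬ (M.relax hH).IsFlat H :=
  not_isFlat_of_natRk_eq (M := M.relax hH) hH.subset_ground hH.ne_ground
    (by rw [natRk_relax_of_subset hH subset_rfl hk, relax_natRank])

theorem IsStressedHyperplane.klPoly_contract_self (hH : M.IsStressedHyperplane H) :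
    klPoly (M ／ H) = 1 :=
  klPoly_of_natRank_eq_one hH.natRank_contract_self hH.1.1.not_isLoop_contract

theorem IsStressedHyperplane.charPoly_contract_self (hH : M.IsStressedHyperplane H) :
    charPoly (M ／ H) = Polynomial.X - 1 :=
  charPoly_of_natRank_eq_one hH.natRank_contract_self hH.1.1.not_isLoop_contract

theorem IsStressedHyperplane.restrict_indep_iff (hH : M.IsStressedHyperplane H)
    (hk : M.natRank ≤ H.ncard) (I : Set α) (hI : I ⊆ (M ↾ H).E) :
    (M ↾ H).Indep I ↔ I.ncard ≤ M.natRank - 1 := by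
  have hI' : I ⊆ H := hI
  have hr := hH.natRk_add_one
  rw [Matroid.restrict_indep_iff, and_iff_left hI']
  constructor
  · intro h
    have := M.natRk_mono hI'
    rw [h.natRk_eq_ncard] at this
    omega
  · exact fun h => hH.indep hk hI' (by omega)

theorem Indep.restrict_indep_iff (hA : M.Indep A) (I : Set α) (hI : I ⊆ (M ↾ A).E) :
    (M ↾ A).Indep I ↔ I.ncard ≤ A.ncard := by
  have hI' : I ⊆ A := hI
  rw [Matroid.restrict_indep_iff, and_iff_left hI']
  exact ⟨fun _ => Set.ncard_le_ncard hI' (M.ground_finite.subset hA.subset_ground),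
    fun _ => hA.subset hI'⟩

theorem Indep.natRank_contract (hA : M.Indep A) : (M ／ A).natRank = M.natRank - A.ncard := by
  have := natRank_contract_add_natRk M A
  rw [hA.natRk_eq_ncard] at this
  omega

theorem klPoly_relax (hH : M.IsStressedHyperplane H) :
    klPoly (M.relax hH) = klPoly M + relaxKLPoly M.natRank H.ncard := by
  classical
  induction hn : M.natRank using Nat.strong_induction_on generalizing M H with
  | _ k ih =>
    by_cases hk : H.ncard < k
    · rw [relaxKLPoly, if_pos hk, relax_eq_self hH (by omega), add_zero]
    subst hn
    have hk' := not_lt.1 hk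
    have hr := hH.natRk_add_one
    have hHne : H ≠ ∅ := by
      rintro rfl
      rw [Set.ncard_empty] at hk'
      omega
    have hEne := (ground_nonempty_of_natRank_ne_zero (M := M) (by omega)).ne_empty
    rw [klPoly_eq_subsetSum (M.relax hH) (by rw [relax_natRank]; omega),
      klPoly_eq_subsetSum M (by omega), relaxKLPoly, if_neg hk, relax_natRank, ← neg_add,
      ← lowHalf_add, relax_ground]
    congr 2
    -- The correction terms are turned back into sums over the subsets of `E`, so that the identity
    -- can be checked for one `A` at a time.
    rw [← subsetSum_ite_subset M.ground_finite hH.subset_ground (fun j =>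
        if _hj : 0 < j ∧ j < M.natRank then charPoly (uniform j j) *
          relaxKLPoly (M.natRank - j) (H.ncard - j) else 0),
      ← subsetSum_ite_eq M.ground_finite subset_rfl (relaxCharPoly M.natRank H.ncard),
      ← subsetSum_ite_eq M.ground_finite hH.subset_ground
        (- charPoly (uniform (M.natRank - 1) H.ncard)),
      ← subsetSum_add M.ground_finite, ← subsetSum_add M.ground_finite,
      ← subsetSum_add M.ground_finite]
    refine subsetSum_congr fun A hA => ?_
    rcases hH.subset_cases hA with ⟨h1, h2⟩ | rfl | rfl | ⟨h1, h2, h3⟩ | ⟨h1, h2, h3, h4, h5⟩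
    · have hne : A ≠ M.E := fun h => hH.ne_ground (hH.subset_ground.antisymm (h ▸ h1))
      have hne' : A ≠ H := by rintro rfl; omega
      have hAi := hH.indep hk' h1 h2
      rw [if_neg hne, if_neg hne', if_pos h1, zero_add, add_zero]
      by_cases h0 : A = ∅
      · simp [h0]
      have hpos : 0 < A.ncard :=
        (Set.ncard_pos (hH.finite.subset h1)).2 (Set.nonempty_iff_ne_empty.2 h0)
      have := M.restrict_finite_of_subset hA
      rw [if_neg h0, if_neg h0, dif_pos ⟨hpos, h2⟩, relax_contract_of_subset hH hk' h1 h2,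
        relax_restrict hH (by rwa [Set.inter_eq_left.2 h1]),
        charPoly_eq_uniform rfl hAi.restrict_indep_iff, restrict_ground_eq,
        ih _ (by omega) (hH.contract hk' h1 h2) hAi.natRank_contract,
        Set.ncard_sdiff h1 (hH.finite.subset h1)]
      ring
    · have := M.restrict_finite_of_subset hA
      rw [if_neg hHne, if_neg hHne, if_neg hH.ne_ground, if_pos subset_rfl, if_pos rfl,
        dif_neg (by omega), klPoly_contract_eq_zero (M := M.relax hH) hA (hH.not_isFlat_relax hk'),
        hH.klPoly_contract_self, charPoly_eq_uniform rfl (hH.restrict_indep_iff hk')]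
      simp
    · have hEH : ¬ M.E ⊆ H := fun h => hH.ne_ground (hH.subset_ground.antisymm h)
      rw [if_neg hEne, if_neg hEne, if_pos rfl, if_neg hEH, if_neg hH.ne_ground.symm,
        relax_contract_of_not_subset hH hA hEH, restrict_ground_eq_self, ← relax_ground hH,
        restrict_ground_eq_self, charPoly_relax, relax_ground, klPoly_contract_ground]
      ring
    · rw [if_neg h1, if_neg h2, if_neg (fun h : A = H => h1 h.subset), relax_restrict hH h3,
        relax_contract_of_not_subset hH hA h1]
      ring
    · have e : ¬ (A ⊆ H ∧ 0 < A.ncard ∧ A.ncard < M.natRank) := by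
        rintro ⟨h6, -, h7⟩
        have := h1 h6
        omega
      rw [klPoly_contract_eq_zero hA h4, klPoly_contract_eq_zero (M := M.relax hH) hA h5,
        if_neg h2, if_neg h3]
      by_cases h6 : A ⊆ H
      · rw [if_pos h6, dif_neg fun h7 => e ⟨h6, h7⟩]
        simp
      · rw [if_neg h6]
        simp

/-- No induction is needed: in every term that survives for both matroids the restriction to `A` is
unchanged, and `charPoly_relax` handles the contraction. -/
theorem invKLPoly_relax (hH : M.IsStressedHyperplane H) :
    invKLPoly (M.relax hH) = invKLPoly M + relaxInvKLPoly M.natRank H.ncard := by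
  classical
  by_cases hk : H.ncard < M.natRank
  · rw [relaxInvKLPoly, if_pos hk, relax_eq_self hH (by omega), add_zero]
  have hk' := not_lt.1 hk
  have hr := hH.natRk_add_one
  rw [invKLPoly_eq_subsetSum (M.relax hH) (by rw [relax_natRank]; omega),
    invKLPoly_eq_subsetSum M (by omega), relaxInvKLPoly, if_neg hk, relax_natRank, ← mul_add,
    ← lowHalf_add, relax_ground]
  congr 2
  rw [← subsetSum_ite_subset M.ground_finite hH.subset_ground (fun j =>
      if j < M.natRank then (-1) ^ j * invKLPoly (uniform j j) * Polynomial.reflect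
        (M.natRank - j) (relaxCharPoly (M.natRank - j) (H.ncard - j)) else 0),
    ← subsetSum_ite_eq M.ground_finite hH.subset_ground
      (- ((-1) ^ (M.natRank - 1) * invKLPoly (uniform (M.natRank - 1) H.ncard) *
        Polynomial.reflect 1 (Polynomial.X - 1))),
    ← subsetSum_add M.ground_finite, ← subsetSum_add M.ground_finite]
  refine subsetSum_congr fun A hA => ?_
  have := M.restrict_finite_of_subset hA
  rcases hH.subset_cases hA with ⟨h1, h2⟩ | rfl | rfl | ⟨h1, h2, h3⟩ | ⟨h1, h2, h3, h4, h5⟩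
  · have hne : A ≠ M.E := fun h => hH.ne_ground (hH.subset_ground.antisymm (h ▸ h1))
    have hne' : A ≠ H := by rintro rfl; omega
    have hAi := hH.indep hk' h1 h2
    have hAH : (A ∩ H).ncard < M.natRank := by rwa [Set.inter_eq_left.2 h1]
    rw [if_neg hne, if_neg hne, if_neg hne', if_pos h1, if_pos h2,
      relax_contract_of_subset hH hk' h1 h2, charPoly_relax, relax_restrict hH hAH,
      natRk_relax_of_lt hH hAH, invKLPoly_eq_uniform rfl hAi.restrict_indep_iff,
      restrict_ground_eq, Polynomial.reflect_add, hAi.natRk_eq_ncard, hAi.natRank_contract,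
      Set.ncard_sdiff h1 (hH.finite.subset h1)]
    ring
  · have e : M.natRank - M.natRk A = 1 := by omega
    have e' : M.natRk A = M.natRank - 1 := by omega
    -- The relaxation gives `H` rank `k`, but its term there vanishes, so only the rank `k - 1` in
    -- `M` enters.
    rw [if_neg hH.ne_ground, if_neg hH.ne_ground, if_pos subset_rfl, if_pos rfl, if_neg hk,
      charPoly_contract_eq_zero (M := M.relax hH) hA (hH.not_isFlat_relax hk'),
      hH.charPoly_contract_self, invKLPoly_eq_uniform rfl (hH.restrict_indep_iff hk'), e, e']
    simp
  · have hEH : ¬ M.E ⊆ H := fun h => hH.ne_ground (hH.subset_ground.antisymm h)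
    rw [if_pos rfl, if_pos rfl, if_neg hEH, if_neg hH.ne_ground.symm]
    ring
  · rw [if_neg h1, if_neg h2, if_neg h2, if_neg (fun h : A = H => h1 h.subset),
      relax_restrict hH h3, relax_contract_of_not_subset hH hA h1,
      natRk_relax_of_not_subset hH hA h1]
    ring
  · rw [charPoly_contract_eq_zero hA h4, charPoly_contract_eq_zero (M := M.relax hH) hA h5,
      if_neg h2, if_neg h3, if_neg h3]
    by_cases h6 : A ⊆ H
    · rw [if_pos h6, if_neg (h1 h6).not_gt]
      simp
    · rw [if_neg h6]
      simp

theorem zPoly_relax (hH : M.IsStressedHyperplane H) :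
    zPoly (M.relax hH) = zPoly M + relaxZPoly M.natRank H.ncard := by
  classical
  by_cases hk : H.ncard < M.natRank
  · rw [relaxZPoly, if_pos hk, relax_eq_self hH (by omega), add_zero]
  have hk' := not_lt.1 hk
  have hr := hH.natRk_add_one
  rw [zPoly_eq_subsetSum, zPoly_eq_subsetSum, relaxZPoly, if_neg hk, relax_ground]
  rw [← subsetSum_ite_subset M.ground_finite hH.subset_ground (fun j =>
      if j < M.natRank then Polynomial.X ^ j *
        relaxKLPoly (M.natRank - j) (H.ncard - j) else 0),
    ← subsetSum_ite_eq M.ground_finite hH.subset_ground (- Polynomial.X ^ (M.natRank - 1)),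
    ← subsetSum_add M.ground_finite, ← subsetSum_add M.ground_finite]
  refine subsetSum_congr fun A hA => ?_
  rcases hH.subset_cases hA with ⟨h1, h2⟩ | rfl | rfl | ⟨h1, h2, h3⟩ | ⟨h1, h2, h3, h4, h5⟩
  · have hne' : A ≠ H := by rintro rfl; omega
    have hAi := hH.indep hk' h1 h2
    have hAH : (A ∩ H).ncard < M.natRank := by rwa [Set.inter_eq_left.2 h1]
    rw [if_neg hne', if_pos h1, if_pos h2, relax_contract_of_subset hH hk' h1 h2, klPoly_relax,
      natRk_relax_of_lt hH hAH, hAi.natRk_eq_ncard, hAi.natRank_contract,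
      Set.ncard_sdiff h1 (hH.finite.subset h1)]
    ring
  · have e' : M.natRk A = M.natRank - 1 := by omega
    rw [if_pos subset_rfl, if_pos rfl, if_neg hk,
      klPoly_contract_eq_zero (M := M.relax hH) hA (hH.not_isFlat_relax hk'),
      hH.klPoly_contract_self, e']
    simp
  · have hEH : ¬ M.E ⊆ H := fun h => hH.ne_ground (hH.subset_ground.antisymm h)
    rw [if_neg hEH, if_neg hH.ne_ground.symm, relax_contract_of_not_subset hH hA hEH,
      natRk_relax_of_not_subset hH hA hEH]
    ring
  · rw [if_neg h1, if_neg (fun h : A = H => h1 h.subset),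
      relax_contract_of_not_subset hH hA h1, natRk_relax_of_not_subset hH hA h1]
    ring
  · rw [klPoly_contract_eq_zero hA h4, klPoly_contract_eq_zero (M := M.relax hH) hA h5,
      if_neg h2]
    by_cases h6 : A ⊆ H
    · rw [if_pos h6, if_neg (h1 h6).not_gt]
      simp
    · rw [if_neg h6]
      simp

end Difference

/-! ### Paving matroids and part (b) -/

section Paving

variable {α : Type u} {M : Matroid α} [M.Finite] {H A : Set α}

theorem IsPaving.indep_of_ncard_lt (hM : M.IsPaving) (hA : A ⊆ M.E) (h : A.ncard < M.natRank) :
    M.Indep A := by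
  rw [indep_iff_forall_subset_not_isCircuit hA]
  intro C hCA hC
  have h1 := hM C hC
  have hf := M.ground_finite.subset hA
  rw [← coe_natRank, ← (hf.subset hCA).cast_ncard_eq, Nat.cast_le] at h1
  have := Set.ncard_le_ncard hCA hf
  omega

/-- A `k`-subset of `H` exceeds the rank of `H`, so it is dependent, while all sets with fewer than
`k` elements are independent. -/
theorem IsPaving.isStressedHyperplane (hM : M.IsPaving) (hH : M.IsHyperplane H) :
    M.IsStressedHyperplane H := by
  refine ⟨hH, fun S hS hSc => ?_⟩
  have hSE := hS.trans hH.1.subset_ground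
  rw [encard_eq_eRank_iff hSE] at hSc
  have hd : M.Dep S := by
    refine ⟨fun hi => ?_, hSE⟩
    have h1 := M.natRk_mono hS
    have h2 := hH.natRk_add_one
    rw [hi.natRk_eq_ncard] at h1
    omega
  refine isCircuit_iff_forall_ssubset.2 ⟨hd, fun I hI =>
    hM.indep_of_ncard_lt (hI.subset.trans hSE) ?_⟩
  rw [← hSc]
  exact Set.ncard_lt_ncard hI (M.ground_finite.subset hSE)

theorem IsPaving.relax (hM : M.IsPaving) (hH : M.IsStressedHyperplane H) :
    (M.relax hH).IsPaving := by
  intro C hC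
  have hCE : C ⊆ M.E := hC.subset_ground
  by_contra hlt
  rw [not_le, ← coe_natRank, relax_natRank, ← (M.ground_finite.subset hCE).cast_ncard_eq,
    Nat.cast_lt] at hlt
  exact hC.not_indep ((relax_indep_iff hH).2 (Or.inl (hM.indep_of_ncard_lt hCE hlt)))

/-- The large hyperplanes of a relaxation are the other large hyperplanes of the matroid. -/
theorem relax_isHyperplane_iff (hH : M.IsStressedHyperplane H) (hA : M.natRank ≤ A.ncard) :
    (M.relax hH).IsHyperplane A ↔ M.IsHyperplane A ∧ A ≠ H := by
  by_cases hAE : A ⊆ M.E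
  swap
  · exact iff_of_false (fun h => hAE h.1.subset_ground) fun h => hAE h.1.1.subset_ground
  by_cases hAH : A ⊆ H
  · refine iff_of_false (fun h => ?_) fun h => h.2 ?_
    · have := h.natRk_add_one
      rw [natRk_relax_of_subset hH hAH hA, relax_natRank] at this
      omega
    · rw [← h.1.1.closure, hH.closure_of_le hAH hA]
  · have hne : A ≠ H := fun h => hAH h.subset
    rw [and_iff_left hne, IsHyperplane, IsHyperplane, relax_eRank, ← coe_natRk, ← coe_natRk,
      natRk_relax_of_not_subset hH hAE hAH, isFlat_iff_closure_eq, isFlat_iff_closure_eq]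
    have : (M.relax hH).closure A = M.closure A := by
      ext e
      by_cases he : e ∈ M.E
      -- Membership in the closure is read off from the ranks of `A` and `insert e A`. Neither set
      -- lies in `H`, so neither rank changes.
      · have key : ∀ (N : Matroid α) [N.Finite], N.E = M.E →
            (e ∈ N.closure A ↔ N.natRk (insert e A) = N.natRk A) := by
          intro N _ hN
          constructor
          · intro h
            rw [natRk, natRk, ← N.eRk_closure_eq (insert e A), closure_insert_eq_of_mem_closure h,
              N.eRk_closure_eq]
          · intro h
            by_contra hn
            have := natRk_insert_of_notMem_closure (hN ▸ he) hn
            omega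
        rw [key M rfl, key (M.relax hH) rfl, natRk_relax_of_not_subset hH hAE hAH,
          natRk_relax_of_not_subset hH (Set.insert_subset he hAE)
            fun h => hAH ((Set.subset_insert e A).trans h)]
      · exact iff_of_false (fun h => he ((M.relax hH).closure_subset_ground A h))
          fun h => he (M.closure_subset_ground A h)
    rw [this]

/-- The bound `hh` is essential: the `(k - 1)`-subsets of `H` become hyperplanes of the relaxation.
-/
theorem numHyperplanes_relax (hH : M.IsStressedHyperplane H) (hk : M.natRank ≤ H.ncard) {h : ℕ}
    (hh : M.natRank ≤ h) : M.numHyperplanes h =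
      (M.relax hH).numHyperplanes h + if h = H.ncard then 1 else 0 := by
  have hfin : {A : Set α | (M.relax hH).IsHyperplane A ∧ A.ncard = h}.Finite :=
    M.ground_finite.finite_subsets.subset fun A hA => hA.1.1.subset_ground
  rw [numHyperplanes, numHyperplanes]
  split_ifs with hc
  · have hnot : H ∉ {A : Set α | (M.relax hH).IsHyperplane A ∧ A.ncard = h} := fun hA =>
      ((relax_isHyperplane_iff hH hk).1 hA.1).2 rfl
    rw [← Set.ncard_insert_of_notMem hnot hfin]
    congr 1
    ext A
    simp only [Set.mem_ofPred_eq, Set.mem_insert_iff]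
    constructor
    · rintro ⟨h1, h2⟩
      by_cases hA : A = H
      · exact Or.inl hA
      · exact Or.inr ⟨(relax_isHyperplane_iff hH (by omega)).2 ⟨h1, hA⟩, h2⟩
    · rintro (rfl | ⟨h1, h2⟩)
      · exact ⟨hH.1, hc.symm⟩
      · exact ⟨((relax_isHyperplane_iff hH (by omega)).1 h1).1, h2⟩
  · rw [add_zero]
    congr 1
    ext A
    simp only [Set.mem_ofPred_eq]
    refine and_congr_left fun h2 => ?_
    rw [relax_isHyperplane_iff hH (by omega), and_iff_left]
    rintro rfl
    exact hc h2.symm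

/-- A paving matroid without large hyperplanes is uniform. -/
theorem IsPaving.indep_iff_of_forall (hM : M.IsPaving)
    (hno : ∀ H, M.IsHyperplane H → H.ncard < M.natRank) (I : Set α) (hI : I ⊆ M.E) :
    M.Indep I ↔ I.ncard ≤ M.natRank := by
  refine ⟨Indep.ncard_le_natRank, fun h => by_contra fun hn => ?_⟩
  have hIf := M.ground_finite.subset hI
  have hc : I.ncard = M.natRank :=
    h.antisymm (not_lt.1 fun hlt => hn (hM.indep_of_ncard_lt hI hlt))
  obtain ⟨e, he⟩ : I.Nonempty := by
    rw [Set.nonempty_iff_ne_empty]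
    rintro rfl
    exact hn M.empty_indep
  have h1 := Set.ncard_sdiff_singleton_add_one he hIf
  have hi : M.Indep (I \ {e}) := hM.indep_of_ncard_lt (Set.sdiff_subset.trans hI) (by omega)
  -- A dependent `k`-set of a paving matroid is a circuit, so its closure is a hyperplane with at
  -- least `k` elements, which `hno` forbids.
  have hcirc : M.IsCircuit I := by
    obtain ⟨C, hCI, hC⟩ := Dep.exists_isCircuit_subset (M := M) ⟨hn, hI⟩
    have h2 := hM C hC
    rw [← coe_natRank, ← (hIf.subset hCI).cast_ncard_eq, Nat.cast_le] at h2
    rwa [← Set.eq_of_subset_of_ncard_le hCI (by omega) hIf]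
  have hhyp : M.IsHyperplane (M.closure I) := by
    refine ⟨M.isFlat_closure I, ?_⟩
    rw [M.eRk_closure_eq, hcirc.eRk_add_one_eq, encard_eq_eRank_iff hI, hc]
  have h3 := hno _ hhyp
  have h4 := Set.ncard_le_ncard (M.subset_closure I hI)
    (M.ground_finite.subset (M.closure_subset_ground I))
  omega

/-- An invariant that changes under relaxation by a quantity depending only on the rank and the
size of the hyperplane is determined on paving matroids by the numbers of hyperplanes. -/
theorem IsPaving.eq_sub_sum {k n : ℕ} (Φ : Matroid α → ℤ[X]) (φ : ℕ → ℤ[X]) (c : ℤ[X])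
    (hrelax : ∀ (M : Matroid α) [M.Finite] (H : Set α) (hH : M.IsStressedHyperplane H),
      M.natRank = k → Φ (M.relax hH) = Φ M + φ H.ncard)
    (hunif : ∀ (M : Matroid α) [M.Finite], M.E.ncard = n →
      (∀ I ⊆ M.E, M.Indep I ↔ I.ncard ≤ k) → Φ M = c)
    (hM : M.IsPaving) (hk : M.natRank = k) (hn : M.E.ncard = n) :
    Φ M = c - ∑ h ∈ Finset.Icc k n, (M.numHyperplanes h : ℤ[X]) * φ h := by
  -- Induction on the number of hyperplanes with at least `k` elements, which drops by one with each
  -- relaxation of such a hyperplane.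
  induction hm : ∑ h ∈ Finset.Icc k n, M.numHyperplanes h generalizing M with
  | zero =>
    rw [Finset.sum_eq_zero_iff] at hm
    rw [hunif M hn, Finset.sum_eq_zero, sub_zero]
    · intro h hh
      rw [hm h hh, Nat.cast_zero, zero_mul]
    · subst hk
      refine hM.indep_iff_of_forall fun H hH => ?_
      by_contra hlt
      have h1 := Set.ncard_le_ncard hH.1.subset_ground M.ground_finite
      have h2 := hm H.ncard (Finset.mem_Icc.2 ⟨not_lt.1 hlt, hn ▸ h1⟩)
      rw [numHyperplanes, Set.ncard_eq_zero (M.ground_finite.finite_subsets.subset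
        fun A hA => hA.1.1.subset_ground)] at h2
      exact (Set.eq_empty_iff_forall_notMem.1 h2 H) ⟨hH, rfl⟩
  | succ m ih =>
    obtain ⟨h, hh, hne⟩ := Finset.exists_ne_zero_of_sum_ne_zero (hm.trans_ne m.succ_ne_zero)
    obtain ⟨H, hH, rfl⟩ := Set.nonempty_of_ncard_ne_zero hne
    have hs := hM.isStressedHyperplane hH
    obtain ⟨hh1, -⟩ := Finset.mem_Icc.1 hh
    have hnum : ∀ h ∈ Finset.Icc k n, M.numHyperplanes h =
        (M.relax hs).numHyperplanes h + if h = H.ncard then 1 else 0 := fun h hh' =>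
      numHyperplanes_relax hs (by omega) (by rw [hk]; exact (Finset.mem_Icc.1 hh').1)
    have h1 := ih (hM.relax hs) (by rw [relax_natRank, hk]) hn (by
      rw [Finset.sum_congr rfl hnum, Finset.sum_add_distrib, Finset.sum_ite_eq', if_pos hh] at hm
      omega)
    have h2 : ∑ h ∈ Finset.Icc k n, (M.numHyperplanes h : ℤ[X]) * φ h =
        ∑ h ∈ Finset.Icc k n, ((M.relax hs).numHyperplanes h : ℤ[X]) * φ h + φ H.ncard := by
      rw [← if_pos hh (t := φ H.ncard) (e := 0), ← Finset.sum_ite_eq' _ _ φ,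
        ← Finset.sum_add_distrib]
      refine Finset.sum_congr rfl fun h hh' => ?_
      rw [hnum h hh']
      split_ifs <;> push_cast <;> ring
    rw [hrelax M H hs hk] at h1
    rw [h2]
    linear_combination h1

end Paving

end Matroid

/-- The sums over `h ≥ k` may stop at `n`, because a hyperplane lies in the ground set. -/
theorem theorem1p3 :
    ∃ p q z : ℕ → ℕ → ℤ[X],
      (∀ k h : ℕ, 1 ≤ k → 1 ≤ h →
        ∀ (α : Type u) (M : Matroid α) [M.Finite] (H : Set α) (hH : M.IsStressedHyperplane H),
          M.natRank = k → H.ncard = h →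
          (M.relax hH).klPoly = M.klPoly + p k h ∧
          (M.relax hH).invKLPoly = M.invKLPoly + q k h ∧
          (M.relax hH).zPoly = M.zPoly + z k h) ∧
      (∀ k n : ℕ, ∀ (α : Type u) (M : Matroid α) [M.Finite],
          M.IsPaving → M.natRank = k → M.E.ncard = n →
          M.klPoly = (Matroid.uniform k n).klPoly
            - ∑ h ∈ Finset.Icc k n, (M.numHyperplanes h : ℤ[X]) * p k h ∧
          M.invKLPoly = (Matroid.uniform k n).invKLPoly
            - ∑ h ∈ Finset.Icc k n, (M.numHyperplanes h : ℤ[X]) * q k h ∧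
          M.zPoly = (Matroid.uniform k n).zPoly
            - ∑ h ∈ Finset.Icc k n, (M.numHyperplanes h : ℤ[X]) * z k h) := by
  refine ⟨Matroid.relaxKLPoly, Matroid.relaxInvKLPoly, Matroid.relaxZPoly, ?_, ?_⟩
  · rintro k h - - α M _ H hH rfl rfl
    exact ⟨Matroid.klPoly_relax hH, Matroid.invKLPoly_relax hH, Matroid.zPoly_relax hH⟩
  · intro k n α M _ hM hk hn
    refine ⟨hM.eq_sub_sum _ _ _ ?_ ?_ hk hn, hM.eq_sub_sum _ _ _ ?_ ?_ hk hn,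
      hM.eq_sub_sum _ _ _ ?_ ?_ hk hn⟩
    · rintro M _ H hH rfl
      exact Matroid.klPoly_relax hH
    · exact fun M _ => Matroid.klPoly_eq_uniform
    · rintro M _ H hH rfl
      exact Matroid.invKLPoly_relax hH
    · exact fun M _ => Matroid.invKLPoly_eq_uniform
    · rintro M _ H hH rfl
      exact Matroid.zPoly_relax hH
    · exact fun M _ => Matroid.zPoly_eq_uniform
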